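/- Let $A,B$ be $n\times n$ complex positive definite matrices and let $f$ be a real continuous function on $(0,\infty)$ with $f>0$ and $f(1)=1$. Assume that either (a) $f$ is operator monotone decreasing, i.e. $0<X\le Y$ implies $f(X)\ge f(Y)$ for bounded positive invertible operators $X,Y$ on any complex Hilbert space (so $f\in\mathrm{OMD}_+^1$), or (b) $f$ is operator convex, i.e. $f(\lambda X+(1-\lambda)Y)\le\lambda f(X)+(1-\lambda)f(Y)$ for all such $X,Y$ and all $\lambda\in[0,1]$, and $\lim_{t\to0^+}f(t)=0$. Put $C:=B^{-1/2}AB^{-1/2}$ and, for positive definite $X,Y$, let $P_f(X,Y):=Y^{1/2}f(Y^{-1/2}XY^{-1/2})Y^{1/2}$. Let $\|\cdot\|_\infty$ be the operator norm, and let $\lambda_1(X)\ge\dots\ge\lambda_n(X)=\lambda_{\min}(X)$ be the eigenvalues of a Hermitian matrix $X$ counted with multiplicity. For positive semidefinite $X,Y$ write $X\prec_{w\log}Y$ if $\prod_{i=1}^k\lambda_i(X)\le\prod_{i=1}^k\lambda_i(Y)$ for all $1\le k\le n$, and $X\prec^{w\log}Y$ if $\prod_{i=1}^k\lambda_{n+1-i}(X)\ge\prod_{i=1}^k\lambda_{n+1-i}(Y)$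 for all $1\le k\le n$. Then for every $p\in[1/2,1]$, $$P_f(A^p,B^p)\prec_{w\log}\Bigl\|\frac{f(C^p)}{f(C)^p}\Bigr\|_\infty\|P_f(A,B)\|_\infty^{1-p}\,P_f(A,B)^{2p-1},$$ $$P_f(A^p,B^p)\prec^{w\log}\lambda_{\min}\Bigl(\frac{f(C^p)}{f(C)^p}\Bigr)\lambda_{\min}(P_f(A,B))^{1-p}\,P_f(A,B)^{2p-1},$$ and for every $p\in[1,2]$, $$\lambda_{\min}\Bigl(\frac{f(C^p)}{f(C)^p}\Bigr)\|P_f(A,B)\|_\infty^{1-p}\,P_f(A,B)^{2p-1}\prec_{w\log}P_f(A^p,B^p),$$ $$\Bigl\|\frac{f(C^p)}{f(C)^p}\Bigr\|_\infty\lambda_{\min}(P_f(A,B))^{1-p}\,P_f(A,B)^{2p-1}\prec^{w\log}P_f(A^p,B^p).$$ -/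

import Mathlib

open Filter Topology
open scoped ComplexOrder

noncomputable section

/-- A real continuous function on `(0, ∞)` is operator monotone if `0 < A ≤ B` implies
`f(A) ≤ f(B)` for bounded operators on an arbitrary complex Hilbert space. Here `A > 0` means
positive and invertible, `≤` is the Loewner order, and `f(A)` is the continuous functional
calculus. Only the values of `f` on `(0, ∞)` matter. -/
def OperatorMonotone (f : ℝ → ℝ) : Prop :=
  ContinuousOn f (Set.Ioi 0) ∧
    ∀ (H : Type) [NormedAddCommGroup H] [InnerProductSpace ℂ H] [CompleteSpace H]
      (A B : H →L[ℂ] H), IsStrictlyPositive A → IsStrictlyPositive B → A ≤ B →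
        cfc f A ≤ cfc f B

/-- `f` is operator monotone decreasing on `(0, ∞)` if `-f` is operator monotone. -/
def OperatorMonotoneDecreasing (f : ℝ → ℝ) : Prop :=
  OperatorMonotone fun t => -f t

/-- A real continuous function on `(0, ∞)` is operator convex if
`f(λ A + (1 - λ) B) ≤ λ f(A) + (1 - λ) f(B)` for all positive invertible bounded operators `A, B`
on an arbitrary complex Hilbert space and all `λ ∈ [0, 1]`. -/
def OperatorConvex (f : ℝ → ℝ) : Prop :=
  ContinuousOn f (Set.Ioi 0) ∧
    ∀ (H : Type) [NormedAddCommGroup H] [InnerProductSpace ℂ H] [CompleteSpace H]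
      (A B : H →L[ℂ] H), IsStrictlyPositive A → IsStrictlyPositive B →
        ∀ l : ℝ, 0 ≤ l → l ≤ 1 →
          cfc f (l • A + (1 - l) • B) ≤ l • cfc f A + (1 - l) • cfc f B

/-- The class `OMD₊¹`: positive operator monotone decreasing functions on `(0, ∞)` with value `1`
at `1`. -/
structure IsOMD1 (g : ℝ → ℝ) : Prop where
  decreasing : OperatorMonotoneDecreasing g
  pos : ∀ t, 0 < t → 0 < g t
  map_one : g 1 = 1

/-- The class `OC₊¹`: positive operator convex functions on `(0, ∞)` with value `1` at `1`. -/
structure IsOC1 (f : ℝ → ℝ) : Prop where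
  convex : OperatorConvex f
  pos : ∀ t, 0 < t → 0 < f t
  map_one : f 1 = 1

variable {ι : Type*} [Fintype ι] [DecidableEq ι]

/-- The real power `A ^ p` of a positive definite matrix, by functional calculus. -/
def matPow (A : Matrix ι ι ℂ) (p : ℝ) : Matrix ι ι ℂ :=
  cfc (fun t : ℝ => t ^ p) A

/-- The matrix `C = B^{-1/2} A B^{-1/2}`. -/
def relMat (A B : Matrix ι ι ℂ) : Matrix ι ι ℂ :=
  matPow B (-(1 / 2)) * A * matPow B (-(1 / 2))

/-- The operator perspective `P_f(A, B) = B^{1/2} f(B^{-1/2} A B^{-1/2}) B^{1/2}`. -/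
def perspective (f : ℝ → ℝ) (A B : Matrix ι ι ℂ) : Matrix ι ι ℂ :=
  matPow B (1 / 2) * cfc f (relMat A B) * matPow B (1 / 2)

/-- The matrix `f(C^p) / f(C)^p` (the two factors commute). -/
def powRatio (f : ℝ → ℝ) (C : Matrix ι ι ℂ) (p : ℝ) : Matrix ι ι ℂ :=
  cfc f (matPow C p) * (matPow (cfc f C) p)⁻¹

/-- The operator norm `‖M‖_∞` of a matrix acting on the Euclidean space. -/
def opNorm (M : Matrix ι ι ℂ) : ℝ :=
  ‖Matrix.toEuclideanCLM (n := ι) (𝕜 := ℂ) M‖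

/-- The smallest eigenvalue of a Hermitian matrix (its spectrum is finite, real, and nonempty
when the matrix has positive size). -/
def lambdaMin (M : Matrix ι ι ℂ) : ℝ :=
  sInf (spectrum ℝ M)

/-- Weak log-majorization `A ≺_{w log} B` of positive semidefinite matrices: for `1 ≤ k ≤ n`, the
product of the `k` largest eigenvalues of `A` is at most that of `B`. The eigenvalues
`eigenvalues₀` are listed in decreasing order with multiplicity. Being positive semidefinite
is part of the assertion. -/
def WeakLogMaj (A B : Matrix ι ι ℂ) : Prop :=
  ∃ (hA : A.PosSemidef) (hB : B.PosSemidef),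
    ∀ k : ℕ, 1 ≤ k → k ≤ Fintype.card ι →
      ∏ i : Fin (Fintype.card ι) with i.val < k, hA.isHermitian.eigenvalues₀ i ≤
        ∏ i : Fin (Fintype.card ι) with i.val < k, hB.isHermitian.eigenvalues₀ i

/-- Log-supermajorization `A ≺^{w log} B` of positive semidefinite matrices: for `1 ≤ k ≤ n`, the
product of the `k` smallest eigenvalues of `A` is at least that of `B`. -/
def LogSupermaj (A B : Matrix ι ι ℂ) : Prop :=
  ∃ (hA : A.PosSemidef) (hB : B.PosSemidef),
    ∀ k : ℕ, 1 ≤ k → k ≤ Fintype.card ι →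
      ∏ i : Fin (Fintype.card ι) with i.val < k, hB.isHermitian.eigenvalues₀ i.rev ≤
        ∏ i : Fin (Fintype.card ι) with i.val < k, hA.isHermitian.eigenvalues₀ i.rev

end

/-! ### Functional calculus, polar decomposition and real powers in a C*-algebra -/

section CStar

variable {𝒜 : Type*} [CStarAlgebra 𝒜] [PartialOrder 𝒜] [StarOrderedRing 𝒜]

/-! Write C = B^{-1/2} A B^{-1/2}, d = f(C), m = B^{-p/2} A^p B^{-p/2} and s = 2p - 1. In case (a)
everything follows from Loewner inequalities such as B^{p/2} f(m) B^{p/2} ≤ K M^{1-p} B^{s/2} d^s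
B^{s/2} for 1/2 ≤ p ≤ 1, where f(C^p) ≤ K d^p and P_f(A,B) ≤ M.

The bound by M says d ≤ M B^{-1}. Hence, with γ = M^{1-p}, the element v = γ^{-1/2} d^{(1-p)/2}
B^{(1-p)/2} is a contraction. Moreover d^{(1-p)/2} C^p d^{(1-p)/2} is the weighted geometric mean C
#_{1-p} d, which is at most γ (C #_{1-p} B^{-1}) = γ B^{-1/2} A^p B^{-1/2}; this gives v* C^p v ≤ m.
Antitonicity and Hansen's inequality yield v f(m) v* ≤ v f(v* C^p v) v* ≤ f(C^p) ≤ K d^p, and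
conjugating v away gives the claim (`ActsDecreasing.conj_cfc_le`, `ActsDecreasing.perspective_le`).
Lower bounds come from the same computation with v an expansion. For p in [1,2] the power 1 - p is
operator antitone, so M and λ_min exchange roles.

Araki's log-majorization then compares B^{s/2} d^s B^{s/2} with P_f(A,B)^s (`araki_le`, `araki_ge`).
Products of the k largest eigenvalues are norms of compound matrices; products of the k smallest are
handled by inverses.

In case (b) the transpose t f(1/t) is operator decreasing by Jensen's operator inequality. Since
P_f(A,B) is its perspective at (B,A), and the ratio of values transforms by t ↦ 1/t, case (b)
reduces to the same argument with A and B exchanged. -/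

theorem cfc_unitary_conj {𝒜 : Type*} [CStarAlgebra 𝒜] (f : ℝ → ℝ) {u a : 𝒜}
    (hu : u ∈ unitary 𝒜) (ha : IsSelfAdjoint a)
    (hf : ContinuousOn f (spectrum ℝ a)) :
    cfc f (u * a * star u) = u * cfc f a * star u := by
  have h := StarAlgHomClass.map_cfc (S := ℝ) (Unitary.conjStarAlgAut ℝ 𝒜 ⟨u, hu⟩) f a hf
    (by change Continuous fun x => u * x * star u; fun_prop) ha
    (ha.map _)
  simpa using h.symm

theorem spectrum_unitary_conj {𝒜 : Type*} [CStarAlgebra 𝒜] {u : 𝒜} (hu : u ∈ unitary 𝒜) (a : 𝒜) :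
    spectrum ℝ (u * a * star u) = spectrum ℝ a := by
  have h := AlgEquiv.spectrum_eq (Unitary.conjStarAlgAut ℝ 𝒜 ⟨u, hu⟩) a
  simpa using h

theorem IsUnit.isStrictlyPositive_star_mul_self {x : 𝒜} (hx : IsUnit x) :
    IsStrictlyPositive (star x * x) :=
  (hx.star.mul hx).isStrictlyPositive (star_mul_self_nonneg x)

theorem IsUnit.isStrictlyPositive_mul_star_self {x : 𝒜} (hx : IsUnit x) :
    IsStrictlyPositive (x * star x) :=
  (hx.mul hx.star).isStrictlyPositive (mul_star_self_nonneg x)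

theorem IsStrictlyPositive.rpow_mul_rpow {a : 𝒜} (ha : IsStrictlyPositive a) (x y : ℝ) :
    a ^ x * a ^ y = a ^ (x + y) := (CFC.rpow_add ha.isUnit).symm

theorem IsStrictlyPositive.rpow_rpow' {a : 𝒜} (ha : IsStrictlyPositive a) (x y : ℝ) :
    (a ^ x) ^ y = a ^ (x * y) := by
  rcases eq_or_ne x 0 with rfl | hx
  · rw [CFC.rpow_zero a ha.nonneg, zero_mul, CFC.rpow_zero a ha.nonneg, CFC.one_rpow]
  · exact CFC.rpow_rpow a x y hx ha

theorem star_rpow (a : 𝒜) (x : ℝ) : star (a ^ x) = a ^ x :=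
  (IsSelfAdjoint.of_nonneg CFC.rpow_nonneg).star_eq

/-- Polar decomposition of an invertible element. -/
theorem IsUnit.exists_unitary_mul {x : 𝒜} (hx : IsUnit x) :
    ∃ u ∈ unitary 𝒜, x = u * (star x * x) ^ (1 / 2 : ℝ) := by
  have hp := hx.isStrictlyPositive_star_mul_self
  set h := star x * x with hh
  have e1 : h ^ (-(1 / 2) : ℝ) * h * h ^ (-(1 / 2) : ℝ) = 1 :=
    CFC.conjugate_rpow_neg_one_half h hp
  refine ⟨x * h ^ (-(1 / 2) : ℝ), ?_, ?_⟩
  · have h1 : star (x * h ^ (-(1 / 2) : ℝ)) * (x * h ^ (-(1 / 2) : ℝ)) = 1 := by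
      rw [star_mul, star_rpow, ← e1, hh]; simp only [mul_assoc]
    have hu : IsUnit (x * h ^ (-(1 / 2) : ℝ)) := hx.mul (hp.rpow _ _).isUnit
    refine ⟨h1, ?_⟩
    have := hu.unit.inv_eq_of_mul_eq_one_left (a := star (x * h ^ (-(1 / 2) : ℝ))) (by simpa using h1)
    rw [← this]
    exact hu.mul_val_inv
  · rw [mul_assoc, CFC.rpow_neg_mul_rpow _ hp, mul_one]

/-- With the polar decomposition x = u h^{1/2}, h = x*x, one has xx* = u h u*, and f(h) commutes
with h^{1/2}. -/
theorem cfc_mul_star_self (f : ℝ → ℝ) {x : 𝒜} (hx : IsUnit x)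
    (hf : ContinuousOn f (Set.Ioi 0)) :
    cfc f (x * star x) * x = x * cfc f (star x * x) := by
  obtain ⟨u, hu, hux⟩ := hx.exists_unitary_mul
  have hp := hx.isStrictlyPositive_star_mul_self
  set h := star x * x with hh
  have hfc : ContinuousOn f (spectrum ℝ h) := hf.mono fun t ht => hp.spectrum_pos ht
  have e : x * star x = u * h * star u := by
    rw [hux, star_mul, star_rpow]
    calc u * h ^ (1 / 2 : ℝ) * (h ^ (1 / 2 : ℝ) * star u)
        = u * (h ^ (1 / 2 : ℝ) * h ^ (1 / 2 : ℝ)) * star u := by simp only [mul_assoc]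
      _ = u * h * star u := by
        rw [hp.rpow_mul_rpow]; norm_num; rw [CFC.rpow_one h hp.nonneg]
  have hc : Commute (cfc f h) (h ^ (1 / 2 : ℝ)) := by
    rw [CFC.rpow_eq_cfc_real hp.nonneg]; exact cfc_commute_cfc _ _ _
  rw [e, cfc_unitary_conj f hu hp.isSelfAdjoint hfc]
  conv_lhs => rw [hux]
  conv_rhs => rw [hux]
  calc u * cfc f h * star u * (u * h ^ (1 / 2 : ℝ))
      = u * cfc f h * (star u * u) * h ^ (1 / 2 : ℝ) := by simp only [mul_assoc]
    _ = u * h ^ (1 / 2 : ℝ) * cfc f h := by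
      rw [Unitary.star_mul_self_of_mem hu, mul_one, mul_assoc, hc.eq, mul_assoc]

theorem spectrum_mul_star_self {x : 𝒜} (hx : IsUnit x) :
    spectrum ℝ (x * star x) = spectrum ℝ (star x * x) := by
  obtain ⟨u, hu, hux⟩ := hx.exists_unitary_mul
  have hp := hx.isStrictlyPositive_star_mul_self
  set h := star x * x with hh
  have e : x * star x = u * h * star u := by
    rw [hux, star_mul, star_rpow]
    calc u * h ^ (1 / 2 : ℝ) * (h ^ (1 / 2 : ℝ) * star u)
        = u * (h ^ (1 / 2 : ℝ) * h ^ (1 / 2 : ℝ)) * star u := by simp only [mul_assoc]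
      _ = u * h * star u := by
        rw [hp.rpow_mul_rpow]; norm_num; rw [CFC.rpow_one h hp.nonneg]
  rw [e, spectrum_unitary_conj hu]

theorem continuousOn_rpow_Ioi (q : ℝ) : ContinuousOn (fun t : ℝ => t ^ q) (Set.Ioi 0) :=
  fun t ht => (Real.continuousAt_rpow_const t q (Or.inl (ne_of_gt ht))).continuousWithinAt

theorem rpow_mul_star_self (q : ℝ) {x : 𝒜} (hx : IsUnit x) :
    (x * star x) ^ q * x = x * (star x * x) ^ q := by
  rw [CFC.rpow_eq_cfc_real (mul_star_self_nonneg x), CFC.rpow_eq_cfc_real (star_mul_self_nonneg x)]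
  exact cfc_mul_star_self _ hx (continuousOn_rpow_Ioi q)

theorem star_mul_rpow_mul (q : ℝ) {x : 𝒜} (hx : IsUnit x) :
    star x * (x * star x) ^ q * x = (star x * x) ^ (q + 1) := by
  have hp := hx.isStrictlyPositive_star_mul_self
  rw [mul_assoc, rpow_mul_star_self q hx, ← mul_assoc, add_comm q, CFC.rpow_add hp.isUnit,
    CFC.rpow_one _ hp.nonneg]

theorem smul_rpow {a : 𝒜} (ha : IsStrictlyPositive a) {c : ℝ} (hc : 0 < c) (q : ℝ) :
    (c • a) ^ q = c ^ q • a ^ q := by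
  have h1 : ContinuousOn (fun t : ℝ => t ^ q) (spectrum ℝ a) :=
    (continuousOn_rpow_Ioi q).mono fun t ht => ha.spectrum_pos ht
  have h2 : ContinuousOn (fun t : ℝ => t ^ q) ((c • ·) '' spectrum ℝ a) :=
    (continuousOn_rpow_Ioi q).mono (by
      rintro _ ⟨t, ht, rfl⟩; exact mul_pos hc (ha.spectrum_pos ht))
  rw [CFC.rpow_eq_cfc_real (ha.smul hc).nonneg, CFC.rpow_eq_cfc_real ha.nonneg,
    ← cfc_smul (c ^ q) _ a h1, ← cfc_comp_smul c _ a h2 ha.isSelfAdjoint]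
  refine cfc_congr fun t ht => ?_
  simp [Real.mul_rpow hc.le (ha.spectrum_pos ht).le]

/-- For exponents in `[-1, 0]` the power function is operator antitone. -/
theorem rpow_le_rpow_of_nonpos {q : ℝ} (h0 : -1 ≤ q) (h1 : q ≤ 0) {a b : 𝒜}
    (ha : IsStrictlyPositive a) (hab : a ≤ b) : b ^ q ≤ a ^ q := by
  have hb : IsStrictlyPositive b := ha.of_le hab
  have h := CStarAlgebra.rpow_neg_one_le_rpow_neg_one
    (CFC.rpow_le_rpow (p := -q) ⟨by linarith, by linarith⟩ hab) (ha.rpow _ _)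
  rwa [ha.rpow_rpow', hb.rpow_rpow', mul_neg_one, neg_neg] at h

theorem star_conj_le {a b : 𝒜} (h : a ≤ b) (c : 𝒜) : star c * a * c ≤ star c * b * c :=
  star_left_conjugate_le_conjugate h c

theorem star_conj_smul {𝒜 : Type*} [CStarAlgebra 𝒜] (K : ℝ) (a c : 𝒜) :
    star c * (K • a) * c = K • (star c * a * c) := by
  rw [mul_smul_comm, smul_mul_assoc]

theorem rpow_conj_le {a b : 𝒜} (h : a ≤ b) (c : 𝒜) (q : ℝ) :
    c ^ q * a * c ^ q ≤ c ^ q * b * c ^ q := by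
  simpa [star_rpow] using star_conj_le h (c ^ q)

end CStar

/-! ### Hansen's inequality for decreasing functions and the conjugation argument -/

section Hansen

variable {𝒜 : Type*} [CStarAlgebra 𝒜] [PartialOrder 𝒜] [StarOrderedRing 𝒜]

/-- A positive continuous function on `(0, ∞)` which acts on the C*-algebra `𝒜` as an operator
monotone decreasing function, in the form of Hansen's inequality for the reciprocal. -/
structure ActsDecreasing (𝒜 : Type*) [CStarAlgebra 𝒜] [PartialOrder 𝒜] [StarOrderedRing 𝒜]
    (f : ℝ → ℝ) : Prop where
  continuousOn : ContinuousOn f (Set.Ioi 0)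
  pos : ∀ t, 0 < t → 0 < f t
  antitone : ∀ a b : 𝒜, IsStrictlyPositive a → a ≤ b → cfc f b ≤ cfc f a
  contraction : ∀ a v : 𝒜, IsStrictlyPositive a → IsUnit v → star v * v ≤ 1 →
    v * cfc f (star v * a * v) * star v ≤ cfc f a

theorem cfc_isStrictlyPositive {f : ℝ → ℝ} (hc : ContinuousOn f (Set.Ioi 0))
    (hf : ∀ t, 0 < t → 0 < f t) {a : 𝒜} (ha : IsStrictlyPositive a) :
    IsStrictlyPositive (cfc f a) := by
  have hc' : ContinuousOn f (spectrum ℝ a) := hc.mono fun t ht => ha.spectrum_pos ht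
  refine IsUnit.isStrictlyPositive ?_ (cfc_nonneg fun t ht => (hf t (ha.spectrum_pos ht)).le)
  rw [isUnit_cfc_iff f a hc' ha.isSelfAdjoint]
  exact fun t ht => (hf t (ha.spectrum_pos ht)).ne'

/-- For w = v⁻¹ one has ww* = (v*v)⁻¹ ≤ 1, and w*w has the same norm as ww*. -/
theorem one_le_star_mul_self_inv {v : 𝒜} (hv : IsUnit v) (h : 1 ≤ star v * v) :
    star (hv.unit⁻¹ : 𝒜ˣ).val * (hv.unit⁻¹ : 𝒜ˣ).val ≤ 1 := by
  set w : 𝒜 := (hv.unit⁻¹ : 𝒜ˣ).val with hw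
  have e1 : v * w = 1 := hv.mul_val_inv
  have e2 : w * star w ≤ 1 := by
    have e4 : w * v = 1 := hv.val_inv_mul
    have e3 : (star v * v) * (w * star w) = 1 := by
      rw [mul_assoc, ← mul_assoc v, e1, one_mul, ← star_mul, e4, star_one]
    have hp := hv.isStrictlyPositive_star_mul_self
    have : w * star w = (star v * v) ^ (-1 : ℝ) := by
      rw [← one_mul (w * star w), ← CFC.rpow_neg_mul_rpow (a := star v * v) 1 hp,
        CFC.rpow_one _ hp.nonneg, mul_assoc, e3, mul_one]
    rw [this]
    exact CStarAlgebra.rpow_neg_one_le_one h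
  have n1 : ‖w * star w‖ ≤ 1 := (CStarAlgebra.norm_le_one_iff_of_nonneg _ (mul_star_self_nonneg w)).2 e2
  refine (CStarAlgebra.norm_le_one_iff_of_nonneg _ (star_mul_self_nonneg w)).1 ?_
  rw [CStarRing.norm_star_mul_self]
  rwa [CStarRing.norm_self_mul_star] at n1

/-- Hansen's inequality for the contraction v⁻¹ at the point v*av, conjugated back by v. All lower
bounds rest on it. -/
theorem ActsDecreasing.expansion {f : ℝ → ℝ} (hf : ActsDecreasing 𝒜 f) {a v : 𝒜}
    (ha : IsStrictlyPositive a) (hv : IsUnit v) (h : 1 ≤ star v * v) :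
    cfc f a ≤ v * cfc f (star v * a * v) * star v := by
  set w : 𝒜 := (hv.unit⁻¹ : 𝒜ˣ).val with hw
  have e1 : v * w = 1 := hv.mul_val_inv
  have e2 : star w * star v = 1 := by rw [← star_mul, e1, star_one]
  have h1 := hf.contraction (star v * a * v) w
    (hv.isStrictlyPositive_star_left_conjugate_iff.2 ha) (Units.isUnit _)
    (one_le_star_mul_self_inv hv h)
  have e3 : star w * (star v * a * v) * w = a := by
    calc star w * (star v * a * v) * w = (star w * star v) * a * (v * w) := by
          simp only [mul_assoc]
      _ = a := by rw [e1, e2, one_mul, mul_one]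
  rw [e3] at h1
  have h2 := star_conj_le h1 (star v)
  rw [star_star] at h2
  calc cfc f a = (v * w) * cfc f a * (star w * star v) := by rw [e1, e2, one_mul, mul_one]
    _ = v * (w * cfc f a * star w) * star v := by simp only [mul_assoc]
    _ ≤ _ := h2

theorem rpow_sandwich {b : 𝒜} (hb : IsStrictlyPositive b) (x y z : ℝ) :
    b ^ x * b ^ y * b ^ z = b ^ (x + y + z) := by
  rw [hb.rpow_mul_rpow, hb.rpow_mul_rpow]

/-- The conjugation step: `v = γ^{-1/2} d^{(1-p)/2} b^{(1-p)/2}`. -/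
theorem conj_rescale {b d m x : 𝒜} {γ p : ℝ} (hb : IsStrictlyPositive b)
    (hd : IsStrictlyPositive d) (hγ : 0 < γ) :
    let v : 𝒜 := (γ ^ (-(1 / 2) : ℝ)) • (d ^ ((1 - p) / 2) * b ^ ((1 - p) / 2))
    let w : 𝒜 := (γ ^ (1 / 2 : ℝ)) • (d ^ (-((1 - p) / 2)) * b ^ ((2 * p - 1) / 2))
    IsUnit v ∧ star v * x * v =
        γ⁻¹ • (b ^ ((1 - p) / 2) * (d ^ ((1 - p) / 2) * x * d ^ ((1 - p) / 2)) * b ^ ((1 - p) / 2)) ∧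
      star w * (v * m * star v) * w = b ^ (p / 2) * m * b ^ (p / 2) ∧
      star w * d ^ p * w = γ • (b ^ ((2 * p - 1) / 2) * d ^ (2 * p - 1) * b ^ ((2 * p - 1) / 2)) := by
  intro v w
  have g1 : γ ^ (-(1 / 2) : ℝ) * γ ^ (-(1 / 2) : ℝ) = γ⁻¹ := by
    rw [← Real.rpow_add hγ, ← Real.rpow_neg_one]; norm_num
  have g2 : γ ^ (1 / 2 : ℝ) * γ ^ (1 / 2 : ℝ) = γ := by
    rw [← Real.rpow_add hγ]; norm_num
  have g3 : γ ^ (-(1 / 2) : ℝ) * γ ^ (1 / 2 : ℝ) = 1 := by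
    rw [← Real.rpow_add hγ]; norm_num
  have sv : star v = (γ ^ (-(1 / 2) : ℝ)) • (b ^ ((1 - p) / 2) * d ^ ((1 - p) / 2)) := by
    simp only [v, star_smul, star_mul, star_rpow, star_trivial]
  have sw : star w = (γ ^ (1 / 2 : ℝ)) • (b ^ ((2 * p - 1) / 2) * d ^ (-((1 - p) / 2))) := by
    simp only [w, star_smul, star_mul, star_rpow, star_trivial]
  have svw : star v * w = b ^ (p / 2) := by
    rw [sv, smul_mul_smul_comm, g3, one_smul]
    calc b ^ ((1 - p) / 2) * d ^ ((1 - p) / 2) * (d ^ (-((1 - p) / 2)) * b ^ ((2 * p - 1) / 2))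
        = b ^ ((1 - p) / 2) * (d ^ ((1 - p) / 2) * d ^ (-((1 - p) / 2))) * b ^ ((2 * p - 1) / 2) := by
          simp only [mul_assoc]
      _ = _ := by
        rw [CFC.rpow_mul_rpow_neg _ hd, mul_one, hb.rpow_mul_rpow]; congr 1; ring
  have swv : star w * v = b ^ (p / 2) := by
    have := congrArg star svw
    rwa [star_mul, star_star, star_rpow] at this
  refine ⟨?_, ?_, ?_, ?_⟩
  · have hu : IsUnit (d ^ ((1 - p) / 2) * b ^ ((1 - p) / 2)) :=
      (hd.rpow _ _).isUnit.mul (hb.rpow _ _).isUnit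
    have : v = (Units.mk0 (γ ^ (-(1 / 2) : ℝ)) (Real.rpow_pos_of_pos hγ _).ne') •
      (d ^ ((1 - p) / 2) * b ^ ((1 - p) / 2)) := rfl
    rw [this]
    exact hu.smul _
  · rw [sv]
    simp only [v, smul_mul_assoc, mul_smul_comm, smul_smul, g1, mul_assoc]
  · calc star w * (v * m * star v) * w = (star w * v) * m * (star v * w) := by simp only [mul_assoc]
      _ = _ := by rw [svw, swv]
  · rw [sw]
    simp only [w, smul_mul_assoc, mul_smul_comm, smul_smul, g2]
    congr 1
    calc b ^ ((2 * p - 1) / 2) * d ^ (-((1 - p) / 2)) * d ^ p *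
          (d ^ (-((1 - p) / 2)) * b ^ ((2 * p - 1) / 2))
        = b ^ ((2 * p - 1) / 2) * (d ^ (-((1 - p) / 2)) * d ^ p * d ^ (-((1 - p) / 2))) *
          b ^ ((2 * p - 1) / 2) := by simp only [mul_assoc]
      _ = _ := by rw [rpow_sandwich hd]; congr 3; ring

theorem rpow_conj_cancel {b : 𝒜} (hb : IsStrictlyPositive b) (q : ℝ) (m : 𝒜) :
    b ^ q * (b ^ (-q) * m * b ^ (-q)) * b ^ q = m := by
  calc b ^ q * (b ^ (-q) * m * b ^ (-q)) * b ^ q = (b ^ q * b ^ (-q)) * m * (b ^ (-q) * b ^ q) := by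
        simp only [mul_assoc]
    _ = m := by rw [CFC.rpow_mul_rpow_neg _ hb, CFC.rpow_neg_mul_rpow _ hb, one_mul, mul_one]

theorem inv_smul_le_of_le_smul {a b : 𝒜} {γ : ℝ} (hγ : 0 < γ) (h : a ≤ γ • b) : γ⁻¹ • a ≤ b := by
  have := smul_le_smul_of_nonneg_left h (inv_pos.2 hγ).le
  rwa [smul_smul, inv_mul_cancel₀ hγ.ne', one_smul] at this

theorem le_inv_smul_of_smul_le {a b : 𝒜} {γ : ℝ} (hγ : 0 < γ) (h : γ • b ≤ a) : b ≤ γ⁻¹ • a := by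
  have := smul_le_smul_of_nonneg_left h (inv_pos.2 hγ).le
  rwa [smul_smul, inv_mul_cancel₀ hγ.ne', one_smul] at this

variable {f : ℝ → ℝ} {b c d m : 𝒜} {γ K p : ℝ}

/-- For the v of `conj_rescale`, `h1` says that v is a contraction and `h2` that v* c^p v ≤ m. Hence
v f(m) v* ≤ f(c^p) ≤ K d^p, and conjugation by w, for which w* v = b^{p/2}, removes v. -/
theorem ActsDecreasing.conj_cfc_le (hf : ActsDecreasing 𝒜 f)
    (hb : IsStrictlyPositive b) (hc : IsStrictlyPositive c) (hd : IsStrictlyPositive d)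
    (hγ : 0 < γ)
    (h1 : d ^ (1 - p) ≤ γ • b ^ (p - 1))
    (h2 : d ^ ((1 - p) / 2) * c ^ p * d ^ ((1 - p) / 2) ≤
      γ • (b ^ ((p - 1) / 2) * m * b ^ ((p - 1) / 2)))
    (h3 : cfc f (c ^ p) ≤ K • d ^ p) :
    b ^ (p / 2) * cfc f m * b ^ (p / 2) ≤
      (K * γ) • (b ^ ((2 * p - 1) / 2) * d ^ (2 * p - 1) * b ^ ((2 * p - 1) / 2)) := by
  have hr := fun x : 𝒜 => conj_rescale (m := cfc f m) (x := x) (p := p) hb hd hγ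
  set v : 𝒜 := (γ ^ (-(1 / 2) : ℝ)) • (d ^ ((1 - p) / 2) * b ^ ((1 - p) / 2))
  set w : 𝒜 := (γ ^ (1 / 2 : ℝ)) • (d ^ (-((1 - p) / 2)) * b ^ ((2 * p - 1) / 2))
  obtain ⟨hv, -, r2, r3⟩ := hr 1
  have hq : (p - 1) / 2 = -((1 - p) / 2) := by ring
  have hvv : star v * v ≤ 1 := by
    have e := (hr 1).2.1
    rw [mul_one] at e
    rw [e, mul_one, hd.rpow_mul_rpow, ← smul_mul_assoc, ← mul_smul_comm]
    have := rpow_conj_le (inv_smul_le_of_le_smul hγ h1) b ((1 - p) / 2)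
    rw [add_halves]
    refine this.trans_eq ?_
    rw [rpow_sandwich hb]
    ring_nf; exact CFC.rpow_zero b hb.nonneg
  have hm : star v * c ^ p * v ≤ m := by
    rw [(hr (c ^ p)).2.1, ← smul_mul_assoc, ← mul_smul_comm]
    refine (rpow_conj_le (inv_smul_le_of_le_smul hγ h2) b ((1 - p) / 2)).trans_eq ?_
    rw [hq, rpow_conj_cancel hb]
  have k1 : cfc f m ≤ cfc f (star v * c ^ p * v) :=
    hf.antitone _ _ (hv.isStrictlyPositive_star_left_conjugate_iff.2 (hc.rpow _ _)) hm
  have k2 := hf.contraction (c ^ p) v (hc.rpow _ _) hv hvv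
  have k3 : v * cfc f m * star v ≤ K • d ^ p := by
    have := star_conj_le k1 (star v)
    rw [star_star] at this
    exact (this.trans k2).trans h3
  have k4 := star_conj_le k3 w
  rw [r2, star_conj_smul, r3, smul_smul] at k4
  exact k4

/-- The mirror image of `ActsDecreasing.conj_cfc_le`: `h1` now makes v an expansion and every
inequality turns around. -/
theorem ActsDecreasing.le_conj_cfc (hf : ActsDecreasing 𝒜 f)
    (hb : IsStrictlyPositive b) (hc : IsStrictlyPositive c) (hd : IsStrictlyPositive d)
    (hm : IsStrictlyPositive m) (hγ : 0 < γ)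
    (h1 : γ • b ^ (p - 1) ≤ d ^ (1 - p))
    (h2 : γ • (b ^ ((p - 1) / 2) * m * b ^ ((p - 1) / 2)) ≤
      d ^ ((1 - p) / 2) * c ^ p * d ^ ((1 - p) / 2))
    (h3 : K • d ^ p ≤ cfc f (c ^ p)) :
    (K * γ) • (b ^ ((2 * p - 1) / 2) * d ^ (2 * p - 1) * b ^ ((2 * p - 1) / 2)) ≤
      b ^ (p / 2) * cfc f m * b ^ (p / 2) := by
  have hr := fun x : 𝒜 => conj_rescale (m := cfc f m) (x := x) (p := p) hb hd hγ
  set v : 𝒜 := (γ ^ (-(1 / 2) : ℝ)) • (d ^ ((1 - p) / 2) * b ^ ((1 - p) / 2))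
  set w : 𝒜 := (γ ^ (1 / 2 : ℝ)) • (d ^ (-((1 - p) / 2)) * b ^ ((2 * p - 1) / 2))
  obtain ⟨hv, -, r2, r3⟩ := hr 1
  have hq : (p - 1) / 2 = -((1 - p) / 2) := by ring
  have hvv : 1 ≤ star v * v := by
    have e := (hr 1).2.1
    rw [mul_one] at e
    rw [e, mul_one, hd.rpow_mul_rpow, ← smul_mul_assoc, ← mul_smul_comm]
    have := rpow_conj_le (le_inv_smul_of_smul_le hγ h1) b ((1 - p) / 2)
    rw [add_halves]
    refine Eq.trans_le ?_ this
    rw [rpow_sandwich hb]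
    ring_nf; exact (CFC.rpow_zero b hb.nonneg).symm
  have hm' : m ≤ star v * c ^ p * v := by
    rw [(hr (c ^ p)).2.1, ← smul_mul_assoc, ← mul_smul_comm]
    refine Eq.trans_le ?_ (rpow_conj_le (le_inv_smul_of_smul_le hγ h2) b ((1 - p) / 2))
    rw [hq, rpow_conj_cancel hb]
  have k1 : cfc f (star v * c ^ p * v) ≤ cfc f m := hf.antitone _ _ hm hm'
  have k2 := hf.expansion (hc.rpow c p) hv hvv
  have k3 : K • d ^ p ≤ v * cfc f m * star v := by
    have := star_conj_le k1 (star v)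
    rw [star_star] at this
    exact h3.trans (k2.trans this)
  have k4 := star_conj_le k3 w
  rw [r2, star_conj_smul, r3, smul_smul] at k4
  exact k4

end Hansen

/-! ### Loewner bounds for perspectives through weighted geometric means -/

section Perspective

variable {𝒜 : Type*} [CStarAlgebra 𝒜] [PartialOrder 𝒜] [StarOrderedRing 𝒜]

theorem cfc_mul_cfc_of_pos {f g : ℝ → ℝ} (hf : ContinuousOn f (Set.Ioi 0))
    (hg : ContinuousOn g (Set.Ioi 0)) {c : 𝒜} (hc : IsStrictlyPositive c) :
    cfc f c * cfc g c = cfc (fun t => f t * g t) c :=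
  (cfc_mul f g c (hf.mono fun _ ht => hc.spectrum_pos ht)
    (hg.mono fun _ ht => hc.spectrum_pos ht)).symm

theorem continuousOn_rpow_comp {f : ℝ → ℝ} (hf : ContinuousOn f (Set.Ioi 0))
    (hpos : ∀ t, 0 < t → 0 < f t) (q : ℝ) : ContinuousOn (fun t => f t ^ q) (Set.Ioi 0) :=
  hf.rpow_const fun t ht => Or.inl (hpos t ht).ne'

theorem rpow_cfc_of_pos {f : ℝ → ℝ} (hf : ContinuousOn f (Set.Ioi 0))
    (hpos : ∀ t, 0 < t → 0 < f t) {c : 𝒜} (hc : IsStrictlyPositive c) (q : ℝ) :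
    cfc f c ^ q = cfc (fun t => f t ^ q) c := by
  rw [CFC.rpow_eq_cfc_real (cfc_isStrictlyPositive hf hpos hc).nonneg]
  rw [← cfc_comp' (fun t : ℝ => t ^ q) f c _ (hf.mono fun t ht => hc.spectrum_pos ht) hc.isSelfAdjoint]
  refine (continuousOn_rpow_Ioi q).mono ?_
  rintro _ ⟨t, ht, rfl⟩
  exact hpos t (hc.spectrum_pos ht)

theorem cfc_rpow_of_pos {f : ℝ → ℝ} (hf : ContinuousOn f (Set.Ioi 0))
    {c : 𝒜} (hc : IsStrictlyPositive c) (q : ℝ) :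
    cfc f (c ^ q) = cfc (fun t => f (t ^ q)) c := by
  rw [CFC.rpow_eq_cfc_real hc.nonneg]
  rw [← cfc_comp' f (fun t : ℝ => t ^ q) c _
    ((continuousOn_rpow_Ioi q).mono fun t ht => hc.spectrum_pos ht) hc.isSelfAdjoint]
  refine hf.mono ?_
  rintro _ ⟨t, ht, rfl⟩
  exact Real.rpow_pos_of_pos (hc.spectrum_pos ht) _

/-- All factors are functions of c, so this is the scalar identity t (f/t)^{1-p} = t^p f^{1-p}. It
exhibits the right side as the geometric mean c #_{1-p} f(c), in which f(c) can be replaced by a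
multiple of b⁻¹. -/
theorem rpow_conj_cfc {f : ℝ → ℝ} (hf : ContinuousOn f (Set.Ioi 0))
    (hpos : ∀ t, 0 < t → 0 < f t) {c : 𝒜} (hc : IsStrictlyPositive c) (p : ℝ) :
    c ^ (1 / 2 : ℝ) * (c ^ (-(1 / 2) : ℝ) * cfc f c * c ^ (-(1 / 2) : ℝ)) ^ (1 - p) *
      c ^ (1 / 2 : ℝ) = cfc f c ^ ((1 - p) / 2) * c ^ p * cfc f c ^ ((1 - p) / 2) := by
  have r := continuousOn_rpow_Ioi
  have h1 : ContinuousOn (fun t : ℝ => t ^ (-(1 / 2) : ℝ) * f t * t ^ (-(1 / 2) : ℝ)) (Set.Ioi 0) :=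
    ((r _).mul hf).mul (r _)
  have h1p : ∀ t : ℝ, 0 < t → 0 < t ^ (-(1 / 2) : ℝ) * f t * t ^ (-(1 / 2) : ℝ) := fun t ht => by
    have := hpos t ht
    positivity
  have h2 := continuousOn_rpow_comp h1 h1p (1 - p)
  have h3 := continuousOn_rpow_comp hf hpos ((1 - p) / 2)
  have h4 : ContinuousOn (fun t : ℝ => t ^ (-(1 / 2) : ℝ) * f t) (Set.Ioi 0) := (r _).mul hf
  have h5 : ContinuousOn (fun t : ℝ => t ^ (1 / 2 : ℝ) *
      (t ^ (-(1 / 2) : ℝ) * f t * t ^ (-(1 / 2) : ℝ)) ^ (1 - p)) (Set.Ioi 0) := (r _).mul h2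
  have h6 : ContinuousOn (fun t : ℝ => f t ^ ((1 - p) / 2) * t ^ p) (Set.Ioi 0) := h3.mul (r _)
  rw [rpow_cfc_of_pos hf hpos hc]
  simp only [CFC.rpow_eq_cfc_real (a := c) hc.nonneg]
  rw [cfc_mul_cfc_of_pos (r _) hf hc, cfc_mul_cfc_of_pos h4 (r _) hc,
    rpow_cfc_of_pos h1 h1p hc, cfc_mul_cfc_of_pos (r _) h2 hc,
    cfc_mul_cfc_of_pos h5 (r _) hc,
    cfc_mul_cfc_of_pos h3 (r _) hc, cfc_mul_cfc_of_pos h6 h3 hc]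
  refine cfc_congr fun t ht => ?_
  have t0 := hc.spectrum_pos ht
  have f0 := hpos t t0
  have e : t ^ (-(1 / 2) : ℝ) * f t * t ^ (-(1 / 2) : ℝ) = t ^ (-1 : ℝ) * f t := by
    rw [mul_right_comm, ← Real.rpow_add t0]; norm_num
  rw [e, Real.mul_rpow (Real.rpow_nonneg t0.le _) f0.le, ← Real.rpow_mul t0.le]
  calc t ^ (1 / 2 : ℝ) * (t ^ (-1 * (1 - p)) * f t ^ (1 - p)) * t ^ (1 / 2 : ℝ)
      = (t ^ (1 / 2 : ℝ) * t ^ (-1 * (1 - p)) * t ^ (1 / 2 : ℝ)) * f t ^ (1 - p) := by ring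
    _ = t ^ p * f t ^ (1 - p) := by
      rw [← Real.rpow_add t0, ← Real.rpow_add t0]; congr 2; ring
    _ = t ^ p * (f t ^ ((1 - p) / 2) * f t ^ ((1 - p) / 2)) := by
      rw [← Real.rpow_add f0, add_halves]
    _ = _ := by ring

/-- Two expressions of a weighted geometric mean. -/
theorem geometric_mean_swap {b c : 𝒜} (hb : IsStrictlyPositive b) (hc : IsStrictlyPositive c)
    (p : ℝ) :
    c ^ (1 / 2 : ℝ) * (c ^ (-(1 / 2) : ℝ) * b ^ (-1 : ℝ) * c ^ (-(1 / 2) : ℝ)) ^ (1 - p) *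
      c ^ (1 / 2 : ℝ) =
    b ^ (-(1 / 2) : ℝ) * (b ^ (1 / 2 : ℝ) * c * b ^ (1 / 2 : ℝ)) ^ p * b ^ (-(1 / 2) : ℝ) := by
  set x : 𝒜 := c ^ (1 / 2 : ℝ) * b ^ (1 / 2 : ℝ) with hx
  -- With x = c^{1/2} b^{1/2}, the two sides involve powers of xx* and of x*x, which
  -- `star_mul_rpow_mul` connects.
  have ux : IsUnit x := (hc.rpow _ _).isUnit.mul (hb.rpow _ _).isUnit
  have sx : star x = b ^ (1 / 2 : ℝ) * c ^ (1 / 2 : ℝ) := by rw [hx, star_mul, star_rpow, star_rpow]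
  have half : ∀ {y : 𝒜}, IsStrictlyPositive y → y ^ (1 / 2 : ℝ) * y ^ (1 / 2 : ℝ) = y :=
    fun hy => by rw [hy.rpow_mul_rpow]; norm_num; exact CFC.rpow_one _ hy.nonneg
  have e1 : star x * x = b ^ (1 / 2 : ℝ) * c * b ^ (1 / 2 : ℝ) := by
    rw [sx, hx]
    calc _ = b ^ (1 / 2 : ℝ) * (c ^ (1 / 2 : ℝ) * c ^ (1 / 2 : ℝ)) * b ^ (1 / 2 : ℝ) := by
          simp only [mul_assoc]
      _ = _ := by rw [half hc]
  have e2 : x * star x = c ^ (1 / 2 : ℝ) * b * c ^ (1 / 2 : ℝ) := by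
    rw [sx, hx]
    calc _ = c ^ (1 / 2 : ℝ) * (b ^ (1 / 2 : ℝ) * b ^ (1 / 2 : ℝ)) * c ^ (1 / 2 : ℝ) := by
          simp only [mul_assoc]
      _ = _ := by rw [half hb]
  have px := ux.isStrictlyPositive_mul_star_self
  have e3 : c ^ (-(1 / 2) : ℝ) * b ^ (-1 : ℝ) * c ^ (-(1 / 2) : ℝ) = (x * star x) ^ (-1 : ℝ) := by
    have i1 : (x * star x) * (c ^ (-(1 / 2) : ℝ) * b ^ (-1 : ℝ) * c ^ (-(1 / 2) : ℝ)) = 1 := by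
      rw [e2]
      calc _ = c ^ (1 / 2 : ℝ) * (b * ((c ^ (1 / 2 : ℝ) * c ^ (-(1 / 2) : ℝ)) * b ^ (-1 : ℝ))) *
            c ^ (-(1 / 2) : ℝ) := by simp only [mul_assoc]
        _ = 1 := by
          rw [CFC.rpow_mul_rpow_neg _ hc, one_mul]
          nth_rewrite 1 [← CFC.rpow_one b hb.nonneg]
          rw [CFC.rpow_mul_rpow_neg _ hb, mul_one, CFC.rpow_mul_rpow_neg _ hc]
    have i2 := CFC.rpow_neg_mul_rpow (1 : ℝ) px
    rw [CFC.rpow_one _ px.nonneg] at i2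
    exact (left_inv_eq_right_inv i2 i1).symm
  rw [e3, px.rpow_rpow', ← e1]
  have e4 := star_mul_rpow_mul (p - 1) ux
  rw [sub_add_cancel] at e4
  rw [← e4, show (-1 : ℝ) * (1 - p) = p - 1 by ring]
  have e5 : b ^ (-(1 / 2) : ℝ) * star x = c ^ (1 / 2 : ℝ) := by
    rw [sx, ← mul_assoc, CFC.rpow_neg_mul_rpow _ hb, one_mul]
  have e6 : x * b ^ (-(1 / 2) : ℝ) = c ^ (1 / 2 : ℝ) := by
    rw [hx, mul_assoc, CFC.rpow_mul_rpow_neg _ hb, mul_one]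
  calc _ = (b ^ (-(1 / 2) : ℝ) * star x) * (x * star x) ^ (p - 1) * (x * b ^ (-(1 / 2) : ℝ)) := by
        rw [e5, e6]
    _ = _ := by simp only [mul_assoc]

variable {f : ℝ → ℝ} {a b : 𝒜} {k K p : ℝ}

theorem rpow_half_conj_neg_half {b : 𝒜} (hb : IsStrictlyPositive b) (a : 𝒜) :
    b ^ (1 / 2 : ℝ) * (b ^ (-(1 / 2) : ℝ) * a * b ^ (-(1 / 2) : ℝ)) * b ^ (1 / 2 : ℝ) = a :=
  rpow_conj_cancel hb (1 / 2) a

theorem isStrictlyPositive_rpow_conj (hb : IsStrictlyPositive b) (ha : IsStrictlyPositive a)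
    (q : ℝ) : IsStrictlyPositive (b ^ q * a * b ^ q) :=
  IsStrictlyPositive.conjugate_of_isUnit_of_isSelfAdjoint a _ (hb.rpow b q).isUnit
    (star_rpow b q) ha

theorem rescaled_power (hb : IsStrictlyPositive b) :
    b ^ ((p - 1) / 2) * ((b ^ p) ^ (-(1 / 2) : ℝ) * a ^ p * (b ^ p) ^ (-(1 / 2) : ℝ)) *
      b ^ ((p - 1) / 2) = b ^ (-(1 / 2) : ℝ) * a ^ p * b ^ (-(1 / 2) : ℝ) := by
  rw [hb.rpow_rpow']
  calc _ = (b ^ ((p - 1) / 2) * b ^ (p * -(1 / 2))) * a ^ p *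
        (b ^ (p * -(1 / 2)) * b ^ ((p - 1) / 2)) := by simp only [mul_assoc]
    _ = _ := by rw [hb.rpow_mul_rpow, hb.rpow_mul_rpow]; congr 3 <;> ring

theorem smul_inv_le_of_smul_one_le {b d : 𝒜} (hb : IsStrictlyPositive b)
    (h : k • (1 : 𝒜) ≤ b ^ (1 / 2 : ℝ) * d * b ^ (1 / 2 : ℝ)) : k • b ^ (-1 : ℝ) ≤ d := by
  have h1 := rpow_conj_le h b (-(1 / 2))
  have e := rpow_conj_cancel hb (-(1 / 2)) d
  rw [neg_neg] at e
  rw [e] at h1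
  refine Eq.trans_le ?_ h1
  rw [mul_smul_comm, smul_mul_assoc, mul_one, hb.rpow_mul_rpow]
  norm_num

theorem le_smul_inv_of_le_smul_one {b d : 𝒜} (hb : IsStrictlyPositive b)
    (h : b ^ (1 / 2 : ℝ) * d * b ^ (1 / 2 : ℝ) ≤ k • (1 : 𝒜)) : d ≤ k • b ^ (-1 : ℝ) := by
  have h1 := rpow_conj_le h b (-(1 / 2))
  have e := rpow_conj_cancel hb (-(1 / 2)) d
  rw [neg_neg] at e
  rw [e] at h1
  refine h1.trans_eq ?_
  rw [mul_smul_comm, smul_mul_assoc, mul_one, hb.rpow_mul_rpow]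
  norm_num

/-- Taken at q = 1 - p, this treats p ≤ 1 and p ≥ 1 together: the power is operator monotone in the
first range and antitone in the second. -/
theorem rpow_le_of_exponent {q : ℝ} {x y : 𝒜}
    (hy : IsStrictlyPositive y)
    (h : (0 ≤ q ∧ q ≤ 1 ∧ x ≤ y) ∨ (-1 ≤ q ∧ q ≤ 0 ∧ y ≤ x)) : x ^ q ≤ y ^ q := by
  rcases h with ⟨h0, h1, h⟩ | ⟨h0, h1, h⟩
  · exact CFC.rpow_le_rpow ⟨h0, h1⟩ h
  · exact rpow_le_rpow_of_nonpos h0 h1 hy h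

/-- The bound on the perspective compares d = f(c) with k b⁻¹. Raising to the power 1 - p gives the
contraction condition, and the geometric means with c give the condition on c^p, both with γ =
k^{1-p}; `ActsDecreasing.conj_cfc_le` then applies. -/
theorem ActsDecreasing.perspective_le (hf : ActsDecreasing 𝒜 f)
    (ha : IsStrictlyPositive a) (hb : IsStrictlyPositive b) (hk : 0 < k) {c : 𝒜}
    (hcdef : c = b ^ (-(1 / 2) : ℝ) * a * b ^ (-(1 / 2) : ℝ))
    (hp : (0 ≤ p ∧ p ≤ 1 ∧ b ^ (1 / 2 : ℝ) * cfc f c * b ^ (1 / 2 : ℝ) ≤ k • 1) ∨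
      (1 ≤ p ∧ p ≤ 2 ∧ k • 1 ≤ b ^ (1 / 2 : ℝ) * cfc f c * b ^ (1 / 2 : ℝ)))
    (hK : ∀ t ∈ spectrum ℝ c, f (t ^ p) ≤ K * f t ^ p) :
    (b ^ p) ^ (1 / 2 : ℝ) * cfc f ((b ^ p) ^ (-(1 / 2) : ℝ) * a ^ p * (b ^ p) ^ (-(1 / 2) : ℝ)) *
        (b ^ p) ^ (1 / 2 : ℝ) ≤
      (K * k ^ (1 - p)) •
        (b ^ ((2 * p - 1) / 2) * cfc f c ^ (2 * p - 1) * b ^ ((2 * p - 1) / 2)) := by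
  have hc : IsStrictlyPositive c := hcdef ▸ isStrictlyPositive_rpow_conj hb ha _
  have hd := cfc_isStrictlyPositive hf.continuousOn hf.pos hc
  set d := cfc f c with hdd
  have hbi : IsStrictlyPositive (k • b ^ (-1 : ℝ)) := (hb.rpow _ _).smul hk
  have hdb : (0 ≤ 1 - p ∧ 1 - p ≤ 1 ∧ d ≤ k • b ^ (-1 : ℝ)) ∨
      (-1 ≤ 1 - p ∧ 1 - p ≤ 0 ∧ k • b ^ (-1 : ℝ) ≤ d) := by
    rcases hp with ⟨h0, h1, h⟩ | ⟨h0, h1, h⟩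
    · exact Or.inl ⟨by linarith, by linarith, le_smul_inv_of_le_smul_one hb h⟩
    · exact Or.inr ⟨by linarith, by linarith, smul_inv_le_of_smul_one_le hb h⟩
  have h1 : d ^ (1 - p) ≤ k ^ (1 - p) • b ^ (p - 1) := by
    have := rpow_le_of_exponent hbi hdb
    rwa [smul_rpow (hb.rpow _ _) hk, hb.rpow_rpow', neg_one_mul, neg_sub] at this
  have hac : b ^ (1 / 2 : ℝ) * c * b ^ (1 / 2 : ℝ) = a := by
    rw [hcdef]; exact rpow_half_conj_neg_half hb a
  have h2 : d ^ ((1 - p) / 2) * c ^ p * d ^ ((1 - p) / 2) ≤ k ^ (1 - p) •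
      (b ^ ((p - 1) / 2) * ((b ^ p) ^ (-(1 / 2) : ℝ) * a ^ p * (b ^ p) ^ (-(1 / 2) : ℝ)) *
      b ^ ((p - 1) / 2)) := by
    rw [rescaled_power hb]
    rw [← hac]
    -- Both sides become geometric means c #_{1-p} y, with y = d on the left and y = k b⁻¹ on the
    -- right.
    rw [← geometric_mean_swap hb hc, ← rpow_conj_cfc hf.continuousOn hf.pos hc,
      ← smul_mul_assoc, ← mul_smul_comm, ← smul_rpow (isStrictlyPositive_rpow_conj hc (hb.rpow _ _) _) hk,
      ← smul_mul_assoc, ← mul_smul_comm]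
    refine rpow_conj_le (rpow_le_of_exponent
      (isStrictlyPositive_rpow_conj hc hbi _) ?_) c _
    exact hdb.imp (fun h => ⟨h.1, h.2.1, rpow_conj_le h.2.2 c _⟩)
      (fun h => ⟨h.1, h.2.1, rpow_conj_le h.2.2 c _⟩)
  have h3 : cfc f (c ^ p) ≤ K • d ^ p := by
    have hco := continuousOn_rpow_comp hf.continuousOn hf.pos p
    have hfp : ContinuousOn (fun t : ℝ => f (t ^ p)) (Set.Ioi 0) :=
      hf.continuousOn.comp (continuousOn_rpow_Ioi p) fun t ht => Real.rpow_pos_of_pos ht p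
    rw [cfc_rpow_of_pos hf.continuousOn hc, hdd, rpow_cfc_of_pos hf.continuousOn hf.pos hc,
      ← cfc_smul K _ c (hco.mono fun t ht => hc.spectrum_pos ht)]
    exact cfc_mono hK (hfp.mono fun t ht => hc.spectrum_pos ht)
      ((hco.mono fun t ht => hc.spectrum_pos ht).const_smul K)
  have := hf.conj_cfc_le hb hc hd (Real.rpow_pos_of_pos hk _) h1 h2 h3
  rwa [hb.rpow_rpow' p (1 / 2), mul_one_div]

theorem ActsDecreasing.le_perspective (hf : ActsDecreasing 𝒜 f)
    (ha : IsStrictlyPositive a) (hb : IsStrictlyPositive b) (hk : 0 < k) {c : 𝒜}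
    (hcdef : c = b ^ (-(1 / 2) : ℝ) * a * b ^ (-(1 / 2) : ℝ))
    (hp : (0 ≤ p ∧ p ≤ 1 ∧ k • 1 ≤ b ^ (1 / 2 : ℝ) * cfc f c * b ^ (1 / 2 : ℝ)) ∨
      (1 ≤ p ∧ p ≤ 2 ∧ b ^ (1 / 2 : ℝ) * cfc f c * b ^ (1 / 2 : ℝ) ≤ k • 1))
    (hK : ∀ t ∈ spectrum ℝ c, K * f t ^ p ≤ f (t ^ p)) :
    (K * k ^ (1 - p)) •
        (b ^ ((2 * p - 1) / 2) * cfc f c ^ (2 * p - 1) * b ^ ((2 * p - 1) / 2)) ≤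
    (b ^ p) ^ (1 / 2 : ℝ) * cfc f ((b ^ p) ^ (-(1 / 2) : ℝ) * a ^ p * (b ^ p) ^ (-(1 / 2) : ℝ)) *
        (b ^ p) ^ (1 / 2 : ℝ) := by
  have hc : IsStrictlyPositive c := hcdef ▸ isStrictlyPositive_rpow_conj hb ha _
  have hd := cfc_isStrictlyPositive hf.continuousOn hf.pos hc
  set d := cfc f c with hdd
  have hbi : IsStrictlyPositive (k • b ^ (-1 : ℝ)) := (hb.rpow _ _).smul hk
  have hdb : (0 ≤ 1 - p ∧ 1 - p ≤ 1 ∧ k • b ^ (-1 : ℝ) ≤ d) ∨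
      (-1 ≤ 1 - p ∧ 1 - p ≤ 0 ∧ d ≤ k • b ^ (-1 : ℝ)) := by
    rcases hp with ⟨h0, h1, h⟩ | ⟨h0, h1, h⟩
    · exact Or.inl ⟨by linarith, by linarith, smul_inv_le_of_smul_one_le hb h⟩
    · exact Or.inr ⟨by linarith, by linarith, le_smul_inv_of_le_smul_one hb h⟩
  have h1 : k ^ (1 - p) • b ^ (p - 1) ≤ d ^ (1 - p) := by
    have := rpow_le_of_exponent hd hdb
    rwa [smul_rpow (hb.rpow _ _) hk, hb.rpow_rpow', neg_one_mul, neg_sub] at this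
  have hac : b ^ (1 / 2 : ℝ) * c * b ^ (1 / 2 : ℝ) = a := by
    rw [hcdef]; exact rpow_half_conj_neg_half hb a
  have h2 : k ^ (1 - p) •
      (b ^ ((p - 1) / 2) * ((b ^ p) ^ (-(1 / 2) : ℝ) * a ^ p * (b ^ p) ^ (-(1 / 2) : ℝ)) *
      b ^ ((p - 1) / 2)) ≤ d ^ ((1 - p) / 2) * c ^ p * d ^ ((1 - p) / 2) := by
    rw [rescaled_power hb]
    rw [← hac]
    rw [← geometric_mean_swap hb hc, ← rpow_conj_cfc hf.continuousOn hf.pos hc,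
      ← smul_mul_assoc, ← mul_smul_comm, ← smul_rpow (isStrictlyPositive_rpow_conj hc (hb.rpow _ _) _) hk,
      ← smul_mul_assoc, ← mul_smul_comm]
    refine rpow_conj_le (rpow_le_of_exponent
      (isStrictlyPositive_rpow_conj hc hd _) ?_) c _
    exact hdb.imp (fun h => ⟨h.1, h.2.1, rpow_conj_le h.2.2 c _⟩)
      (fun h => ⟨h.1, h.2.1, rpow_conj_le h.2.2 c _⟩)
  have h3 : K • d ^ p ≤ cfc f (c ^ p) := by
    have hco := continuousOn_rpow_comp hf.continuousOn hf.pos p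
    have hfp : ContinuousOn (fun t : ℝ => f (t ^ p)) (Set.Ioi 0) :=
      hf.continuousOn.comp (continuousOn_rpow_Ioi p) fun t ht => Real.rpow_pos_of_pos ht p
    rw [cfc_rpow_of_pos hf.continuousOn hc, hdd, rpow_cfc_of_pos hf.continuousOn hf.pos hc,
      ← cfc_smul K _ c (hco.mono fun t ht => hc.spectrum_pos ht)]
    exact cfc_mono hK ((hco.mono fun t ht => hc.spectrum_pos ht).const_smul K)
      (hfp.mono fun t ht => hc.spectrum_pos ht)
  have := hf.le_conj_cfc hb hc hd (isStrictlyPositive_rpow_conj (hb.rpow _ _) (ha.rpow _ _) _)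
    (Real.rpow_pos_of_pos hk _) h1 h2 h3
  rwa [hb.rpow_rpow' p (1 / 2), mul_one_div]

end Perspective

/-! ### Passage from operators to matrices; block matrices and unitary dilation -/

section MatrixOrderFunctions

open scoped MatrixOrder Matrix.Norms.L2Operator
open Matrix

theorem toEuclideanCLM_cfc {m : Type*} [Fintype m] [DecidableEq m] (f : ℝ → ℝ)
    {X : Matrix m m ℂ} (hX : IsSelfAdjoint X) :
    toEuclideanCLM (n := m) (𝕜 := ℂ) (cfc f X) = cfc f (toEuclideanCLM (n := m) (𝕜 := ℂ) X) := by
  have hc : Continuous (toEuclideanCLM (n := m) (𝕜 := ℂ)) :=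
    (AddMonoidHomClass.isometry_of_norm (toEuclideanCLM (n := m) (𝕜 := ℂ))
      fun A => l2_opNorm_toEuclideanCLM A).continuous
  exact StarAlgHomClass.map_cfc (R := ℝ) (S := ℂ) (toEuclideanCLM (n := m) (𝕜 := ℂ)) f X
    (X.finite_real_spectrum.continuousOn f) hc hX (hX.map _)

theorem toEuclideanCLM_le_iff {m : Type*} [Fintype m] [DecidableEq m] {X Y : Matrix m m ℂ} :
    toEuclideanCLM (n := m) (𝕜 := ℂ) X ≤ toEuclideanCLM (n := m) (𝕜 := ℂ) Y ↔ X ≤ Y :=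
  map_le_map_iff _

theorem toEuclideanCLM_isStrictlyPositive {m : Type*} [Fintype m] [DecidableEq m]
    {X : Matrix m m ℂ} (hX : IsStrictlyPositive X) :
    IsStrictlyPositive (toEuclideanCLM (n := m) (𝕜 := ℂ) X) := by
  refine (hX.isUnit.map _).isStrictlyPositive ?_
  have := (toEuclideanCLM_le_iff (X := (0 : Matrix m m ℂ)) (Y := X)).2 hX.nonneg
  rwa [map_zero] at this

theorem OperatorMonotoneDecreasing.matrix_antitone {f : ℝ → ℝ} (hf : OperatorMonotoneDecreasing f)
    {m : Type} [Fintype m] [DecidableEq m] {X Y : Matrix m m ℂ} (hX : IsStrictlyPositive X)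
    (hXY : X ≤ Y) : cfc f Y ≤ cfc f X := by
  have hY := hX.of_le hXY
  have h := hf.2 (EuclideanSpace ℂ m) _ _ (toEuclideanCLM_isStrictlyPositive hX)
    (toEuclideanCLM_isStrictlyPositive hY) (toEuclideanCLM_le_iff.2 hXY)
  rw [cfc_neg, cfc_neg, neg_le_neg_iff, ← toEuclideanCLM_cfc f hX.isSelfAdjoint,
    ← toEuclideanCLM_cfc f hY.isSelfAdjoint] at h
  exact toEuclideanCLM_le_iff.1 h

/-- The weight 1/2 suffices, because the block-diagonal part of a matrix is the midpoint of two
unitary conjugates. -/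
theorem OperatorConvex.matrix_midpoint {f : ℝ → ℝ} (hf : OperatorConvex f)
    {m : Type} [Fintype m] [DecidableEq m] {X Y : Matrix m m ℂ} (hX : IsStrictlyPositive X)
    (hY : IsStrictlyPositive Y) :
    cfc f ((1 / 2 : ℝ) • X + (1 / 2 : ℝ) • Y) ≤ (1 / 2 : ℝ) • cfc f X + (1 / 2 : ℝ) • cfc f Y := by
  have h := hf.2 (EuclideanSpace ℂ m) _ _ (toEuclideanCLM_isStrictlyPositive hX)
    (toEuclideanCLM_isStrictlyPositive hY) (1 / 2) (by norm_num) (by norm_num)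
  have hs : ∀ (r : ℝ) (Z : Matrix m m ℂ), r • toEuclideanCLM (n := m) (𝕜 := ℂ) Z =
      toEuclideanCLM (n := m) (𝕜 := ℂ) (r • Z) := fun r Z => by
    rw [← Complex.coe_smul r Z, map_smul]
    ext x i
    simp
  rw [show (1 - 1 / 2 : ℝ) = 1 / 2 by norm_num, hs, hs, ← map_add,
    ← toEuclideanCLM_cfc f hX.isSelfAdjoint, ← toEuclideanCLM_cfc f hY.isSelfAdjoint,
    ← toEuclideanCLM_cfc f, hs, hs, ← map_add] at h
  · exact toEuclideanCLM_le_iff.1 h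
  · exact ((hX.smul (c := (1 / 2 : ℝ)) (by norm_num)).isSelfAdjoint).add
      (hY.smul (c := (1 / 2 : ℝ)) (by norm_num)).isSelfAdjoint

variable {m : Type*} [Fintype m] [DecidableEq m]

/-- Block diagonal matrices as a star homomorphism. -/
def blockDiagHom (m : Type*) [Fintype m] [DecidableEq m] :
    (Matrix m m ℂ × Matrix m m ℂ) →⋆ₐ[ℝ] Matrix (m ⊕ m) (m ⊕ m) ℂ where
  toFun p := fromBlocks p.1 0 0 p.2
  map_one' := fromBlocks_one
  map_mul' p q := by simp [fromBlocks_multiply]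
  map_zero' := fromBlocks_zero
  map_add' p q := by simp [fromBlocks_add]
  commutes' r := by
    simp only [Algebra.algebraMap_eq_smul_one, Prod.smul_fst, Prod.smul_snd, Prod.fst_one,
      Prod.snd_one]
    rw [← fromBlocks_one, fromBlocks_smul, smul_zero]
  map_star' p := by simp [star_eq_conjTranspose, fromBlocks_conjTranspose]

theorem cfc_fromBlocks_diagonal (f : ℝ → ℝ) {X Y : Matrix m m ℂ} (hX : IsSelfAdjoint X)
    (hY : IsSelfAdjoint Y) :
    cfc f (fromBlocks X 0 0 Y) = fromBlocks (cfc f X) 0 0 (cfc f Y) := by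
  have hc : Continuous (blockDiagHom m) := by
    change Continuous fun p : Matrix m m ℂ × Matrix m m ℂ => fromBlocks p.1 0 0 p.2
    fun_prop
  have hp : IsSelfAdjoint (X, Y) := by
    ext1
    · exact hX
    · exact hY
  have hs : (spectrum ℝ X ∪ spectrum ℝ Y).Finite :=
    X.finite_real_spectrum.union Y.finite_real_spectrum
  have : ContinuousFunctionalCalculus ℝ (Matrix m m ℂ × Matrix m m ℂ) IsSelfAdjoint :=
    IsSelfAdjoint.instContinuousFunctionalCalculus
  have h := StarAlgHomClass.map_cfc (R := ℝ) (S := ℝ) (blockDiagHom m) f (X, Y)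
    (by rw [Prod.spectrum_eq]; exact hs.continuousOn f) hc hp (hp.map _)
  rw [cfc_map_prod (S := ℝ) f X Y (hs.continuousOn f) hp hX hY] at h
  exact h.symm

theorem toBlocks₁₁_mono {m : Type*} {P Q : Matrix (m ⊕ m) (m ⊕ m) ℂ} (h : P ≤ Q) :
    P.toBlocks₁₁ ≤ Q.toBlocks₁₁ := by
  have h' : (Q - P).PosSemidef := h
  exact h'.submatrix Sum.inl

/-- The unitary dilation of a self-adjoint contraction. -/
theorem halmos_unitary {T S : Matrix m m ℂ} (hT : IsSelfAdjoint T) (hS : IsSelfAdjoint S)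
    (hc : Commute T S) (hs : T * T + S * S = 1) :
    fromBlocks T S S (-T) ∈ unitary (Matrix (m ⊕ m) (m ⊕ m) ℂ) ∧
      star (fromBlocks T S S (-T)) = fromBlocks T S S (-T) := by
  have e : star (fromBlocks T S S (-T)) = fromBlocks T S S (-T) := by
    rw [star_eq_conjTranspose, fromBlocks_conjTranspose, conjTranspose_neg,
      ← star_eq_conjTranspose, ← star_eq_conjTranspose, hT.star_eq, hS.star_eq]
  have e2 : fromBlocks T S S (-T) * fromBlocks T S S (-T) = 1 := by
    rw [fromBlocks_multiply, ← fromBlocks_one]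
    congr 1
    · rw [mul_neg, hc.eq, add_neg_cancel]
    · rw [neg_mul, hc.eq, add_neg_cancel]
    · rw [neg_mul_neg, add_comm, hs]
  refine ⟨⟨?_, ?_⟩, e⟩ <;> rw [e, e2]

theorem halmos_conj (T S X Y : Matrix m m ℂ) :
    fromBlocks T S S (-T) * fromBlocks X 0 0 Y * fromBlocks T S S (-T) =
      fromBlocks (T * X * T + S * Y * S) (T * X * S - S * Y * T) (S * X * T - T * Y * S)
        (S * X * S + T * Y * T) := by
  simp [fromBlocks_multiply, sub_eq_add_neg]

/-- S = (1 - T²)^{1/2} is a function of 1 - T² and therefore commutes with T. -/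
theorem exists_halmos {T : Matrix m m ℂ} (hT : 0 ≤ T) (h1 : T * T ≤ 1) :
    ∃ S : Matrix m m ℂ, IsSelfAdjoint S ∧ Commute T S ∧ T * T + S * S = 1 := by
  have hTs : IsSelfAdjoint T := .of_nonneg hT
  have h0 : 0 ≤ 1 - T * T := sub_nonneg.2 h1
  refine ⟨CFC.sqrt (1 - T * T), .of_nonneg (CFC.sqrt_nonneg _), ?_, ?_⟩
  · rw [CFC.sqrt_eq_real_sqrt _ h0, cfcₙ_eq_cfc]
    have hc : Commute (1 - T * T) T :=
      ((Commute.one_left T).sub_left ((Commute.refl T).mul_left (Commute.refl T)))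
    exact (hc.cfc_real _).symm
  · rw [CFC.sqrt_mul_sqrt_self _ h0, add_sub_cancel]

/-- The difference is W*W with first block row (√ε, -Q/√ε). Decoupling the blocks costs only ε in
the upper corner; the large term sits in the lower corner, which is discarded later. -/
theorem fromBlocks_le_diagonal (P Q R : Matrix m m ℂ) {ε : ℝ} (hε : 0 < ε) :
    fromBlocks P Q Qᴴ R ≤ fromBlocks (P + ε • 1) 0 0 (R + ε⁻¹ • (Qᴴ * Q)) := by
  obtain ⟨r, t, g1, g2, g3⟩ : ∃ r t : ℝ, r * r = ε ∧ t * t = ε⁻¹ ∧ r * t = 1 := by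
    refine ⟨√ε, (√ε)⁻¹, Real.mul_self_sqrt hε.le, ?_, mul_inv_cancel₀ (Real.sqrt_pos.2 hε).ne'⟩
    rw [← mul_inv, Real.mul_self_sqrt hε.le]
  set W : Matrix (m ⊕ m) (m ⊕ m) ℂ := fromBlocks (r • 1) (-(t • Q)) 0 0 with hW
  have e : fromBlocks (P + ε • 1) 0 0 (R + ε⁻¹ • (Qᴴ * Q)) - fromBlocks P Q Qᴴ R = Wᴴ * W := by
    rw [hW, fromBlocks_conjTranspose, fromBlocks_multiply, sub_eq_add_neg, fromBlocks_neg,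
      fromBlocks_add]
    simp [conjTranspose_smul, smul_smul, g1, g2, g3, mul_comm t r]
  rw [Matrix.le_iff, e]
  exact posSemidef_conjTranspose_mul_self W

end MatrixOrderFunctions

/-! ### Hansen's and Jensen's inequalities by dilation -/

section MatrixHansen

open scoped MatrixOrder Matrix.Norms.L2Operator
open Matrix

variable {m : Type*} [Fintype m] [DecidableEq m]

theorem tendsto_cfc_add_smul {f : ℝ → ℝ} (hf : ContinuousOn f (Set.Ioi 0)) {X Y : Matrix m m ℂ}
    (hX : IsStrictlyPositive X) (hY : 0 ≤ Y) :
    Tendsto (fun ε : ℝ => cfc f (X + ε • Y)) (𝓝[>] 0) (𝓝 (cfc f X)) := by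
  have hsp : ∀ ε ∈ Set.Ici (0 : ℝ), IsStrictlyPositive (X + ε • Y) := fun ε hε =>
    hX.add_nonneg (smul_nonneg hε hY)
  have hc : ContinuousOn (fun ε : ℝ => cfc f (X + ε • Y)) (Set.Ici 0) := by
    refine ContinuousOn.cfc_of_mem_nhdsSet (s := Set.Ioi 0) f ?_ (by fun_prop)
      (fun ε hε => (hsp ε hε).isSelfAdjoint) hf
    rw [isOpen_Ioi.mem_nhdsSet]
    exact Set.iUnion₂_subset fun ε hε t ht => (hsp ε hε).spectrum_pos ht
  have h := (hc 0 Set.self_mem_Ici).tendsto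
  simp only [zero_smul, add_zero] at h
  exact h.mono_left (nhdsWithin_mono _ Set.Ioi_subset_Ici_self)

theorem isStrictlyPositive_smul_one {ε : ℝ} (hε : 0 < ε) :
    IsStrictlyPositive (ε • (1 : Matrix m m ℂ)) := isStrictlyPositive_one.smul hε

theorem cfc_smul_one (f : ℝ → ℝ) (ε : ℝ) :
    cfc f (ε • (1 : Matrix m m ℂ)) = f ε • (1 : Matrix m m ℂ) := by
  rw [← Algebra.algebraMap_eq_smul_one, cfc_algebraMap, Algebra.algebraMap_eq_smul_one]

theorem fromBlocks_isStrictlyPositive {X Y : Matrix m m ℂ} (hX : IsStrictlyPositive X)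
    (hY : IsStrictlyPositive Y) : IsStrictlyPositive (fromBlocks X 0 0 Y) := by
  refine (isUnit_fromBlocks_zero₂₁.2 ⟨hX.isUnit, hY.isUnit⟩).isStrictlyPositive ?_
  obtain ⟨a, ha⟩ := CStarAlgebra.nonneg_iff_eq_star_mul_self.1 hX.nonneg
  obtain ⟨b, hb⟩ := CStarAlgebra.nonneg_iff_eq_star_mul_self.1 hY.nonneg
  have : fromBlocks X 0 0 Y = star (fromBlocks a 0 0 b) * fromBlocks a 0 0 b := by
    rw [ha, hb, star_eq_conjTranspose (fromBlocks a 0 0 b), fromBlocks_conjTranspose,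
      fromBlocks_multiply]
    simp [star_eq_conjTranspose]
  rw [this]
  exact star_mul_self_nonneg _

/-- Hansen's inequality for positive operator monotone functions, for positive contractions. -/
theorem hansen_of_monotone {g : ℝ → ℝ} (hc : ContinuousOn g (Set.Ioi 0))
    (hpos : ∀ t, 0 < t → 0 < g t)
    (hg : ∀ X Y : Matrix (m ⊕ m) (m ⊕ m) ℂ, IsStrictlyPositive X → X ≤ Y → cfc g X ≤ cfc g Y)
    {X T : Matrix m m ℂ} (hX : IsStrictlyPositive X) (hT : IsStrictlyPositive T)
    (hT1 : T * T ≤ 1) : T * cfc g X * T ≤ cfc g (T * X * T) := by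
  obtain ⟨S, hS, hTS, hs⟩ := exists_halmos hT.nonneg hT1
  obtain ⟨hU, hUs⟩ := halmos_unitary hT.isSelfAdjoint hS hTS hs
  have hTXT : IsStrictlyPositive (T * X * T) :=
    IsStrictlyPositive.conjugate_of_isUnit_of_isSelfAdjoint X T hT.isUnit hT.isSelfAdjoint hX
  have hSS : 0 ≤ S * S := by
    have := star_mul_self_nonneg S
    rwa [hS.star_eq] at this
  -- X ⊕ ε is conjugated by the Halmos unitary, dominated by a block-diagonal matrix, and the upper
  -- left corners are compared. Taking ε instead of 0 keeps the block matrix strictly positive.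
  have key : ∀ ε : ℝ, 0 < ε → T * cfc g X * T ≤ cfc g (T * X * T + ε • (S * S + 1)) := by
    intro ε hε
    set U := fromBlocks T S S (-T) with hUdef
    have hD : IsStrictlyPositive (fromBlocks X 0 0 (ε • (1 : Matrix m m ℂ))) :=
      fromBlocks_isStrictlyPositive hX (isStrictlyPositive_smul_one hε)
    have hUD := cfc_unitary_conj g hU hD.isSelfAdjoint
      ((finite_real_spectrum (A := _)).continuousOn g)
    rw [hUs, cfc_fromBlocks_diagonal g hX.isSelfAdjoint
      (isStrictlyPositive_smul_one hε).isSelfAdjoint, cfc_smul_one, hUdef, halmos_conj,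
      halmos_conj] at hUD
    have hH : IsStrictlyPositive (U * fromBlocks X 0 0 (ε • (1 : Matrix m m ℂ)) * U) := by
      have := (Unitary.isUnit_coe (U := ⟨U, hU⟩)).isStrictlyPositive_star_right_conjugate_iff.2 hD
      rwa [hUs] at this
    rw [hUdef, halmos_conj] at hH
    set P := T * X * T + S * (ε • (1 : Matrix m m ℂ)) * S with hP
    set Q := T * X * S - S * (ε • (1 : Matrix m m ℂ)) * T with hQ
    set R := S * X * S + T * (ε • (1 : Matrix m m ℂ)) * T with hR
    have hQ' : S * X * T - T * (ε • (1 : Matrix m m ℂ)) * S = Qᴴ := by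
      rw [hQ, ← star_eq_conjTranspose]
      simp only [star_sub, star_mul, star_smul, star_one, star_trivial, hT.isSelfAdjoint.star_eq,
        hS.star_eq, hX.isSelfAdjoint.star_eq, mul_assoc]
    rw [hQ'] at hH hUD
    have hle := fromBlocks_le_diagonal P Q R hε
    have hK := hH.of_le hle
    have h1 := toBlocks₁₁_mono (hg _ _ hH hle)
    have hPs : IsSelfAdjoint (P + ε • 1) := by
      have := congrArg toBlocks₁₁ hK.isSelfAdjoint.star_eq
      rwa [star_eq_conjTranspose, fromBlocks_conjTranspose, toBlocks_fromBlocks₁₁,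
        toBlocks_fromBlocks₁₁] at this
    have hRs : IsSelfAdjoint (R + ε⁻¹ • (Qᴴ * Q)) := by
      have := congrArg toBlocks₂₂ hK.isSelfAdjoint.star_eq
      rwa [star_eq_conjTranspose, fromBlocks_conjTranspose, toBlocks_fromBlocks₂₂,
        toBlocks_fromBlocks₂₂] at this
    rw [hUD, cfc_fromBlocks_diagonal g hPs hRs, toBlocks_fromBlocks₁₁, toBlocks_fromBlocks₁₁] at h1
    have e : P + ε • 1 = T * X * T + ε • (S * S + 1) := by
      rw [hP, mul_smul_comm, smul_mul_assoc, mul_one, smul_add, add_assoc]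
    rw [e] at h1
    refine le_trans ?_ h1
    rw [mul_smul_comm, smul_mul_assoc, mul_one]
    -- Positivity of g allows the term g(ε) S² to be dropped.
    exact le_add_of_nonneg_right (smul_nonneg (hpos ε hε).le hSS)
  have hlim := tendsto_cfc_add_smul hc hTXT (add_nonneg hSS zero_le_one)
  exact ge_of_tendsto hlim (by filter_upwards [self_mem_nhdsWithin] with ε hε using key ε hε)

/-- The operator Jensen inequality for positive contractions. -/
theorem jensen_of_convex {f : ℝ → ℝ} (hc : ContinuousOn f (Set.Ioi 0))
    (h0 : Tendsto f (𝓝[>] 0) (𝓝 0))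
    (hf : ∀ X Y : Matrix (m ⊕ m) (m ⊕ m) ℂ, IsStrictlyPositive X → IsStrictlyPositive Y →
      cfc f ((1 / 2 : ℝ) • X + (1 / 2 : ℝ) • Y) ≤ (1 / 2 : ℝ) • cfc f X + (1 / 2 : ℝ) • cfc f Y)
    {X T : Matrix m m ℂ} (hX : IsStrictlyPositive X) (hT : IsStrictlyPositive T)
    (hT1 : T * T ≤ 1) : cfc f (T * X * T) ≤ T * cfc f X * T := by
  obtain ⟨S, hS, hTS, hs⟩ := exists_halmos hT.nonneg hT1
  obtain ⟨hU, hUs⟩ := halmos_unitary hT.isSelfAdjoint hS hTS hs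
  have hTXT : IsStrictlyPositive (T * X * T) :=
    IsStrictlyPositive.conjugate_of_isUnit_of_isSelfAdjoint X T hT.isUnit hT.isSelfAdjoint hX
  have hSS : 0 ≤ S * S := by
    have := star_mul_self_nonneg S
    rwa [hS.star_eq] at this
  have key : ∀ ε : ℝ, 0 < ε →
      cfc f (T * X * T + ε • (S * S)) ≤ T * cfc f X * T + f ε • (S * S) := by
    intro ε hε
    set U := fromBlocks T S S (-T) with hUdef
    have hD : IsStrictlyPositive (fromBlocks X 0 0 (ε • (1 : Matrix m m ℂ))) :=
      fromBlocks_isStrictlyPositive hX (isStrictlyPositive_smul_one hε)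
    have hUD := cfc_unitary_conj f hU hD.isSelfAdjoint
      ((finite_real_spectrum (A := _)).continuousOn f)
    rw [hUs, cfc_fromBlocks_diagonal f hX.isSelfAdjoint
      (isStrictlyPositive_smul_one hε).isSelfAdjoint, cfc_smul_one, hUdef, halmos_conj,
      halmos_conj] at hUD
    have hH : IsStrictlyPositive (U * fromBlocks X 0 0 (ε • (1 : Matrix m m ℂ)) * U) := by
      have := (Unitary.isUnit_coe (U := ⟨U, hU⟩)).isStrictlyPositive_star_right_conjugate_iff.2 hD
      rwa [hUs] at this
    rw [hUdef, halmos_conj] at hH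
    -- Averaging a block matrix with its conjugate by J = 1 ⊕ (-1) erases the off-diagonal blocks.
    -- Midpoint convexity thus bounds f of the diagonal part by the diagonal part of f.
    set J : Matrix (m ⊕ m) (m ⊕ m) ℂ := fromBlocks 1 0 0 (-1) with hJ
    have hJs : star J = J := by
      rw [hJ, star_eq_conjTranspose, fromBlocks_conjTranspose]; simp
    have hJJ : J * J = 1 := by rw [hJ, fromBlocks_multiply]; simp
    have hJu : J ∈ unitary (Matrix (m ⊕ m) (m ⊕ m) ℂ) := by
      constructor <;> rw [hJs, hJJ]
    have hJc : ∀ a b c d : Matrix m m ℂ,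
        J * fromBlocks a b c d * star J = fromBlocks a (-b) (-c) d := fun a b c d => by
      rw [hJs, hJ, fromBlocks_multiply, fromBlocks_multiply]; simp
    have hav : ∀ a b c d : Matrix m m ℂ, (1 / 2 : ℝ) • fromBlocks a b c d +
        (1 / 2 : ℝ) • (J * fromBlocks a b c d * star J) = fromBlocks a 0 0 d := fun a b c d => by
      rw [hJc, fromBlocks_smul, fromBlocks_smul, fromBlocks_add]
      have : ∀ a : Matrix m m ℂ, (1 / 2 : ℝ) • a + (1 / 2 : ℝ) • a = a := fun a => by
        rw [← add_smul]; norm_num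
      simp only [smul_neg, add_neg_cancel, this]
    have hH' := (Unitary.isUnit_coe (U := ⟨J, hJu⟩)).isStrictlyPositive_star_right_conjugate_iff.2 hH
    have h1 := hf _ _ hH hH'
    rw [hav, cfc_unitary_conj f hJu hH.isSelfAdjoint ((finite_real_spectrum (A := _)).continuousOn f),
      hUD, hav] at h1
    have hPs : IsSelfAdjoint (T * X * T + S * (ε • (1 : Matrix m m ℂ)) * S) := by
      have := congrArg toBlocks₁₁ hH.isSelfAdjoint.star_eq
      rwa [star_eq_conjTranspose, fromBlocks_conjTranspose, toBlocks_fromBlocks₁₁,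
        toBlocks_fromBlocks₁₁] at this
    have hRs : IsSelfAdjoint (S * X * S + T * (ε • (1 : Matrix m m ℂ)) * T) := by
      have := congrArg toBlocks₂₂ hH.isSelfAdjoint.star_eq
      rwa [star_eq_conjTranspose, fromBlocks_conjTranspose, toBlocks_fromBlocks₂₂,
        toBlocks_fromBlocks₂₂] at this
    rw [cfc_fromBlocks_diagonal f hPs hRs] at h1
    have h2 := toBlocks₁₁_mono h1
    rw [toBlocks_fromBlocks₁₁, toBlocks_fromBlocks₁₁] at h2
    simpa only [mul_smul_comm, smul_mul_assoc, mul_one] using h2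
  have hlim := tendsto_cfc_add_smul hc hTXT hSS
  -- Here f(0+) = 0 removes the remainder f(ε) S².
  have hlim2 : Tendsto (fun ε : ℝ => T * cfc f X * T + f ε • (S * S)) (𝓝[>] 0)
      (𝓝 (T * cfc f X * T)) := by
    have := (tendsto_const_nhds (x := T * cfc f X * T) (f := 𝓝[>] (0 : ℝ))).add
      (h0.smul_const (S * S))
    rwa [zero_smul, add_zero] at this
  exact le_of_tendsto_of_tendsto hlim hlim2
    (by filter_upwards [self_mem_nhdsWithin] with ε hε using key ε hε)

end MatrixHansen

/-! ### Both classes of functions yield decreasing actions on matrices -/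

section ActsOnMatrices

open scoped MatrixOrder Matrix.Norms.L2Operator
open Matrix

theorem isStrictlyPositive_unitary_conj {𝒜 : Type*} [CStarAlgebra 𝒜] [PartialOrder 𝒜]
    [StarOrderedRing 𝒜] {u a : 𝒜} (hu : u ∈ unitary 𝒜) (ha : IsStrictlyPositive a) :
    IsStrictlyPositive (star u * a * u) :=
  (Unitary.isUnit_coe (U := ⟨u, hu⟩)).isStrictlyPositive_star_left_conjugate_iff.2 ha

theorem cfc_star_unitary_conj {𝒜 : Type*} [CStarAlgebra 𝒜] (f : ℝ → ℝ) {u a : 𝒜}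
    (hu : u ∈ unitary 𝒜) (ha : IsSelfAdjoint a) (hf : ContinuousOn f (spectrum ℝ a)) :
    cfc f (star u * a * u) = star u * cfc f a * u := by
  have := cfc_unitary_conj f (Unitary.star_mem hu) ha hf
  rwa [star_star] at this

theorem star_conj_polar {𝒜 : Type*} [CStarAlgebra 𝒜] [PartialOrder 𝒜] [StarOrderedRing 𝒜]
    {u T v : 𝒜} (hT : IsSelfAdjoint T) (h : v = u * T) (a : 𝒜) :
    star v * a * v = T * (star u * a * u) * T := by
  rw [h, star_mul, hT.star_eq]; simp only [mul_assoc]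

/-- Polar decomposition of an invertible contraction. -/
theorem exists_polar_contraction {𝒜 : Type*} [CStarAlgebra 𝒜] [PartialOrder 𝒜]
    [StarOrderedRing 𝒜] {v : 𝒜} (hv : IsUnit v) (h : star v * v ≤ 1) :
    ∃ u ∈ unitary 𝒜, ∃ T : 𝒜, IsStrictlyPositive T ∧ T * T ≤ 1 ∧ v = u * T := by
  obtain ⟨u, hu, huv⟩ := hv.exists_unitary_mul
  have hp := hv.isStrictlyPositive_star_mul_self
  refine ⟨u, hu, _, hp.rpow _ _, ?_, huv⟩
  rw [hp.rpow_mul_rpow]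
  norm_num
  rwa [CFC.rpow_one _ hp.nonneg]

theorem rpow_neg_one_antitone_iff {𝒜 : Type*} [CStarAlgebra 𝒜] [PartialOrder 𝒜]
    [StarOrderedRing 𝒜] {a b : 𝒜} (ha : IsStrictlyPositive a) (hb : IsStrictlyPositive b)
    (h : b ^ (-1 : ℝ) ≤ a ^ (-1 : ℝ)) : a ≤ b := by
  have := CStarAlgebra.rpow_neg_one_le_rpow_neg_one h (hb.rpow _ _)
  rw [ha.rpow_rpow', hb.rpow_rpow'] at this
  norm_num at this
  rwa [CFC.rpow_one _ ha.nonneg, CFC.rpow_one _ hb.nonneg] at this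

theorem cfc_rpow_neg_one_exponent {f : ℝ → ℝ} {𝒜 : Type*} [CStarAlgebra 𝒜] [PartialOrder 𝒜]
    [StarOrderedRing 𝒜] (hc : ContinuousOn f (Set.Ioi 0)) (hpos : ∀ t, 0 < t → 0 < f t)
    {a : 𝒜} (ha : IsStrictlyPositive a) :
    cfc (fun t => f t ^ (-1 : ℝ)) a = cfc f a ^ (-1 : ℝ) := (rpow_cfc_of_pos hc hpos ha _).symm

/-- The reciprocal 1/f is operator monotone, so Hansen's inequality holds for it; inversion gives
f(TbT) ≤ T⁻¹ f(b) T⁻¹, and the polar decomposition v = uT passes from T to v. Antitonicity is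
required in every size because the dilation doubles the size. -/
theorem ActsDecreasing.of_antitone {f : ℝ → ℝ} (hc : ContinuousOn f (Set.Ioi 0))
    (hpos : ∀ t, 0 < t → 0 < f t)
    (hanti : ∀ (m : Type) [Fintype m] [DecidableEq m] (X Y : Matrix m m ℂ),
      IsStrictlyPositive X → X ≤ Y → cfc f Y ≤ cfc f X)
    (m : Type) [Fintype m] [DecidableEq m] : ActsDecreasing (Matrix m m ℂ) f where
  continuousOn := hc
  pos := hpos
  antitone := hanti m
  contraction a v ha hv h := by
    obtain ⟨u, hu, T, hT, hT1, huv⟩ := exists_polar_contraction hv h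
    have hb := isStrictlyPositive_unitary_conj hu ha
    set b := star u * a * u with hbdef
    have hcb : cfc f b = star u * cfc f a * u :=
      cfc_star_unitary_conj f hu ha.isSelfAdjoint (hc.mono fun t ht => ha.spectrum_pos ht)
    have hgm : ∀ X Y : Matrix (m ⊕ m) (m ⊕ m) ℂ, IsStrictlyPositive X → X ≤ Y →
        cfc (fun t => f t ^ (-1 : ℝ)) X ≤ cfc (fun t => f t ^ (-1 : ℝ)) Y := fun X Y hX hXY => by
      have hY := hX.of_le hXY
      rw [cfc_rpow_neg_one_exponent hc hpos hX, cfc_rpow_neg_one_exponent hc hpos hY]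
      exact CStarAlgebra.rpow_neg_one_le_rpow_neg_one (hanti _ _ _ hX hXY)
        (cfc_isStrictlyPositive hc hpos hY)
    have hTbT : IsStrictlyPositive (T * b * T) :=
      IsStrictlyPositive.conjugate_of_isUnit_of_isSelfAdjoint b T hT.isUnit hT.isSelfAdjoint hb
    have h1 := hansen_of_monotone (continuousOn_rpow_comp hc hpos (-1))
      (fun t ht => Real.rpow_pos_of_pos (hpos t ht) _) hgm hb hT hT1
    rw [cfc_rpow_neg_one_exponent hc hpos hb, cfc_rpow_neg_one_exponent hc hpos hTbT] at h1
    have hfb := cfc_isStrictlyPositive hc hpos hb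
    have hfT := cfc_isStrictlyPositive hc hpos hTbT
    have h2 : cfc f (T * b * T) ≤ T ^ (-1 : ℝ) * cfc f b * T ^ (-1 : ℝ) := by
      refine rpow_neg_one_antitone_iff hfT (isStrictlyPositive_rpow_conj hT hfb _) ?_
      refine Eq.trans_le ?_ h1
      have i1 : (T ^ (-1 : ℝ) * cfc f b * T ^ (-1 : ℝ)) * (T * cfc f b ^ (-1 : ℝ) * T) = 1 := by
        have t1 : T ^ (-1 : ℝ) * T = 1 := by
          have := CFC.rpow_neg_mul_rpow (1 : ℝ) hT
          rwa [CFC.rpow_one _ hT.nonneg] at this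
        have t2 : cfc f b * cfc f b ^ (-1 : ℝ) = 1 := by
          have := CFC.rpow_mul_rpow_neg (1 : ℝ) hfb
          rwa [CFC.rpow_one _ hfb.nonneg] at this
        calc _ = T ^ (-1 : ℝ) * (cfc f b * ((T ^ (-1 : ℝ) * T) * cfc f b ^ (-1 : ℝ))) * T := by
              simp only [mul_assoc]
          _ = 1 := by rw [t1, one_mul, t2, mul_one, t1]
      have hq := isStrictlyPositive_rpow_conj hT hfb (-1)
      have i2 := CFC.rpow_neg_mul_rpow (1 : ℝ) hq
      rw [CFC.rpow_one _ hq.nonneg] at i2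
      exact left_inv_eq_right_inv i2 i1
    have h3 : T * cfc f (T * b * T) * T ≤ cfc f b := by
      have := rpow_conj_le h2 T 1
      rw [rpow_conj_cancel hT, CFC.rpow_one _ hT.nonneg] at this
      exact this
    have h4 := star_conj_le h3 (star u)
    rw [star_star, hcb] at h4
    rw [star_conj_polar hT.isSelfAdjoint huv a]
    have huu := Unitary.mul_star_self_of_mem hu
    calc v * cfc f (T * b * T) * star v = u * (T * cfc f (T * b * T) * T) * star u := by
          rw [huv, star_mul, hT.isSelfAdjoint.star_eq]; simp only [mul_assoc]
      _ ≤ _ := h4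
      _ = (u * star u) * cfc f a * (u * star u) := by simp only [mul_assoc]
      _ = cfc f a := by rw [huu, one_mul, mul_one]

theorem IsOMD1.actsDecreasing {f : ℝ → ℝ} (hf : IsOMD1 f) (m : Type) [Fintype m]
    [DecidableEq m] : ActsDecreasing (Matrix m m ℂ) f := by
  refine .of_antitone ?_ hf.pos (fun m _ _ X Y hX hXY => hf.decreasing.matrix_antitone hX hXY) m
  exact hf.decreasing.1.neg.congr fun t _ => (neg_neg (f t)).symm

theorem jensen_contraction {f : ℝ → ℝ} (hf : OperatorConvex f) (h0 : Tendsto f (𝓝[>] 0) (𝓝 0))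
    {m : Type} [Fintype m] [DecidableEq m] {X v : Matrix m m ℂ} (hX : IsStrictlyPositive X)
    (hv : IsUnit v) (h : star v * v ≤ 1) :
    cfc f (star v * X * v) ≤ star v * cfc f X * v := by
  obtain ⟨u, hu, T, hT, hT1, huv⟩ := exists_polar_contraction hv h
  rw [star_conj_polar hT.isSelfAdjoint huv, star_conj_polar hT.isSelfAdjoint huv,
    ← cfc_star_unitary_conj f hu hX.isSelfAdjoint (hf.1.mono fun t ht => hX.spectrum_pos ht)]
  exact jensen_of_convex hf.1 h0 (fun X Y hX hY => hf.matrix_midpoint hX hY)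
    (isStrictlyPositive_unitary_conj hu hX) hT hT1

/-- The transpose `t ↦ t f(1/t)` of a function on the half line. -/
noncomputable def transposeFun (f : ℝ → ℝ) (t : ℝ) : ℝ := t * f (t ^ (-1 : ℝ))

theorem continuousOn_transposeFun {f : ℝ → ℝ} (hf : ContinuousOn f (Set.Ioi 0)) :
    ContinuousOn (transposeFun f) (Set.Ioi 0) :=
  continuousOn_id.mul (hf.comp (continuousOn_rpow_Ioi (-1)) fun _ ht => Real.rpow_pos_of_pos ht _)

theorem transposeFun_pos {f : ℝ → ℝ} (hf : ∀ t, 0 < t → 0 < f t) {t : ℝ} (ht : 0 < t) :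
    0 < transposeFun f t := mul_pos ht (hf _ (Real.rpow_pos_of_pos ht _))

theorem cfc_transposeFun {𝒜 : Type*} [CStarAlgebra 𝒜] [PartialOrder 𝒜] [StarOrderedRing 𝒜]
    {f : ℝ → ℝ} (hf : ContinuousOn f (Set.Ioi 0)) {X : 𝒜} (hX : IsStrictlyPositive X) :
    cfc (transposeFun f) X = X ^ (1 / 2 : ℝ) * cfc f (X ^ (-1 : ℝ)) * X ^ (1 / 2 : ℝ) := by
  have hfi : ContinuousOn (fun t : ℝ => f (t ^ (-1 : ℝ))) (Set.Ioi 0) :=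
    hf.comp (continuousOn_rpow_Ioi (-1)) fun _ ht => Real.rpow_pos_of_pos ht _
  have r := continuousOn_rpow_Ioi (1 / 2)
  have h1 : ContinuousOn (fun t : ℝ => t ^ (1 / 2 : ℝ) * f (t ^ (-1 : ℝ))) (Set.Ioi 0) := r.mul hfi
  rw [cfc_rpow_of_pos hf hX, CFC.rpow_eq_cfc_real (a := X) hX.nonneg, cfc_mul_cfc_of_pos r hfi hX,
    cfc_mul_cfc_of_pos h1 r hX]
  refine cfc_congr fun t ht => ?_
  have t0 := hX.spectrum_pos ht
  calc t * f (t ^ (-1 : ℝ)) = (t ^ (1 / 2 : ℝ) * t ^ (1 / 2 : ℝ)) * f (t ^ (-1 : ℝ)) := by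
        rw [← Real.rpow_add t0]; norm_num
    _ = _ := by ring

/-- Put x = X⁻¹ ≥ y = Y⁻¹. Then v = x^{-1/2} y^{1/2} is a contraction with v*xv = y, so Jensen gives
f(y) ≤ v* f(x) v; conjugation by y^{-1/2} turns this into y^{-1/2} f(y) y^{-1/2} ≤ x^{-1/2} f(x)
x^{-1/2}. -/
theorem IsOC1.transposeFun_antitone {f : ℝ → ℝ} (hf : IsOC1 f) (h0 : Tendsto f (𝓝[>] 0) (𝓝 0))
    {m : Type} [Fintype m] [DecidableEq m] {X Y : Matrix m m ℂ} (hX : IsStrictlyPositive X)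
    (hXY : X ≤ Y) : cfc (transposeFun f) Y ≤ cfc (transposeFun f) X := by
  have hY := hX.of_le hXY
  set x := X ^ (-1 : ℝ) with hx
  set y := Y ^ (-1 : ℝ) with hy
  have px : IsStrictlyPositive x := hX.rpow _ _
  have py : IsStrictlyPositive y := hY.rpow _ _
  have hyx : y ≤ x := CStarAlgebra.rpow_neg_one_le_rpow_neg_one hXY hX
  have hXx : X ^ (1 / 2 : ℝ) = x ^ (-(1 / 2) : ℝ) := by rw [hx, hX.rpow_rpow']; norm_num
  have hYy : Y ^ (1 / 2 : ℝ) = y ^ (-(1 / 2) : ℝ) := by rw [hy, hY.rpow_rpow']; norm_num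
  rw [cfc_transposeFun hf.convex.1 hX, cfc_transposeFun hf.convex.1 hY, ← hx, ← hy, hXx, hYy]
  set v := x ^ (-(1 / 2) : ℝ) * y ^ (1 / 2 : ℝ) with hv
  have sv : star v = y ^ (1 / 2 : ℝ) * x ^ (-(1 / 2) : ℝ) := by
    rw [hv, star_mul, star_rpow, star_rpow]
  have hvu : IsUnit v := (px.rpow _ _).isUnit.mul (py.rpow _ _).isUnit
  have hvx : star v * x * v = y := by
    rw [sv, hv]
    calc _ = y ^ (1 / 2 : ℝ) * (x ^ (-(1 / 2) : ℝ) * x * x ^ (-(1 / 2) : ℝ)) * y ^ (1 / 2 : ℝ) := by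
          simp only [mul_assoc]
      _ = y := by
        rw [CFC.conjugate_rpow_neg_one_half x px, mul_one, py.rpow_mul_rpow]
        norm_num; exact CFC.rpow_one _ py.nonneg
  have hv1 : star v * v ≤ 1 := by
    have e : star v * v = y ^ (1 / 2 : ℝ) * x ^ (-1 : ℝ) * y ^ (1 / 2 : ℝ) := by
      rw [sv, hv]
      calc _ = y ^ (1 / 2 : ℝ) * (x ^ (-(1 / 2) : ℝ) * x ^ (-(1 / 2) : ℝ)) * y ^ (1 / 2 : ℝ) := by
            simp only [mul_assoc]
        _ = _ := by rw [px.rpow_mul_rpow]; norm_num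
    rw [e]
    refine (rpow_conj_le (CStarAlgebra.rpow_neg_one_le_rpow_neg_one hyx py) y (1 / 2)).trans_eq ?_
    rw [rpow_sandwich py]; norm_num; exact CFC.rpow_zero _ py.nonneg
  have h1 := jensen_contraction hf.convex h0 px hvu hv1
  rw [hvx] at h1
  have h2 := rpow_conj_le h1 y (-(1 / 2))
  refine h2.trans_eq ?_
  rw [sv, hv]
  calc _ = (y ^ (-(1 / 2) : ℝ) * y ^ (1 / 2 : ℝ)) * (x ^ (-(1 / 2) : ℝ) * cfc f x *
        x ^ (-(1 / 2) : ℝ)) * (y ^ (1 / 2 : ℝ) * y ^ (-(1 / 2) : ℝ)) := by simp only [mul_assoc]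
    _ = _ := by
      rw [CFC.rpow_neg_mul_rpow _ py, CFC.rpow_mul_rpow_neg _ py, one_mul, mul_one]

theorem IsOC1.actsDecreasing_transposeFun {f : ℝ → ℝ} (hf : IsOC1 f)
    (h0 : Tendsto f (𝓝[>] 0) (𝓝 0)) (m : Type) [Fintype m] [DecidableEq m] :
    ActsDecreasing (Matrix m m ℂ) (transposeFun f) :=
  .of_antitone (continuousOn_transposeFun hf.convex.1) (fun _ ht => transposeFun_pos hf.pos ht)
    (fun _ _ _ _ _ hX hXY => hf.transposeFun_antitone h0 hX hXY) m

end ActsOnMatrices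

/-! ### Compound matrices and products of the largest eigenvalues -/

section Compound

open scoped MatrixOrder Matrix.Norms.L2Operator Nat
open Matrix

variable {ι : Type*} [Fintype ι] [DecidableEq ι]

/-- The normalized matrix of all `k × k` minors, with rows and columns indexed by arbitrary
`k`-tuples: the compression of the `k`-fold tensor power to antisymmetric tensors. -/
noncomputable def minorMat (k : ℕ) (M : Matrix ι ι ℂ) : Matrix (Fin k → ι) (Fin k → ι) ℂ :=
  of fun a b => (k ! : ℂ)⁻¹ * (M.submatrix a b).det

omit [Fintype ι] [DecidableEq ι] in
theorem minorMat_apply (k : ℕ) (M : Matrix ι ι ℂ) (a b : Fin k → ι) :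
    minorMat k M a b = (k ! : ℂ)⁻¹ * (M.submatrix a b).det := rfl

omit [DecidableEq ι] in
theorem sum_det_submatrix_mul_prod {k : ℕ} (M N : Matrix ι ι ℂ) (a c : Fin k → ι) :
    ∑ b : Fin k → ι, (M.submatrix a b).det * ∏ i, N (b i) (c i) =
      ((M * N).submatrix a c).det := by
  simp only [det_apply', Finset.sum_mul, submatrix_apply, mul_apply]
  rw [Finset.sum_comm]
  refine Finset.sum_congr rfl fun σ _ => ?_
  rw [Finset.prod_univ_sum, Fintype.piFinset_univ, Finset.mul_sum]
  refine Finset.sum_congr rfl fun b _ => ?_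
  rw [mul_assoc, Finset.prod_mul_distrib]

omit [DecidableEq ι] in
-- Cauchy–Binet summed over all tuples. Expanding the second determinant, each permutation
-- contributes the same amount, since reindexing b absorbs its sign; hence the factor k!.
theorem sum_det_submatrix_mul_det {k : ℕ} (M N : Matrix ι ι ℂ) (a c : Fin k → ι) :
    ∑ b : Fin k → ι, (M.submatrix a b).det * (N.submatrix b c).det =
      (k ! : ℂ) * ((M * N).submatrix a c).det := by
  have h : ∀ σ : Equiv.Perm (Fin k), ∑ b : Fin k → ι, (M.submatrix a b).det *
      ((σ.sign : ℂ) * ∏ i, N (b (σ i)) (c i)) = ((M * N).submatrix a c).det := fun σ => by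
    rw [← sum_det_submatrix_mul_prod M N a c]
    refine Fintype.sum_equiv (Equiv.arrowCongr σ.symm (Equiv.refl ι)) _ _ fun b => ?_
    have e : (M.submatrix a (b ∘ σ)).det = (σ.sign : ℂ) * (M.submatrix a b).det := by
      have := det_permute' σ (M.submatrix a b)
      rwa [submatrix_submatrix] at this
    have e2 : (Equiv.arrowCongr σ.symm (Equiv.refl ι)) b = b ∘ σ := by
      ext i; simp [Equiv.arrowCongr]
    rw [e2, e]
    simp only [Function.comp_apply]
    ring
  simp_rw [det_apply' (N.submatrix _ c), Finset.mul_sum, submatrix_apply]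
  rw [Finset.sum_comm, Finset.sum_congr rfl fun σ _ => h σ]
  simp [Fintype.card_perm]

omit [DecidableEq ι] in
theorem minorMat_mul (k : ℕ) (M N : Matrix ι ι ℂ) :
    minorMat k (M * N) = minorMat k M * minorMat k N := by
  ext a c
  have hk : (k ! : ℂ) ≠ 0 := by exact_mod_cast k.factorial_ne_zero
  rw [mul_apply, minorMat_apply]
  have : ∀ b, minorMat k M a b * minorMat k N b c =
      (k ! : ℂ)⁻¹ * (k ! : ℂ)⁻¹ * ((M.submatrix a b).det * (N.submatrix b c).det) := fun b => by
    rw [minorMat_apply, minorMat_apply]; ring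
  rw [Finset.sum_congr rfl fun b _ => this b, ← Finset.mul_sum, sum_det_submatrix_mul_det]
  field_simp

omit [Fintype ι] [DecidableEq ι] in
theorem minorMat_conjTranspose (k : ℕ) (M : Matrix ι ι ℂ) :
    minorMat k Mᴴ = (minorMat k M)ᴴ := by
  ext a b
  rw [conjTranspose_apply, minorMat_apply, minorMat_apply, ← conjTranspose_submatrix,
    det_conjTranspose]
  simp

omit [Fintype ι] [DecidableEq ι] in
theorem minorMat_smul (k : ℕ) (r : ℝ) (M : Matrix ι ι ℂ) :
    minorMat k (r • M) = r ^ k • minorMat k M := by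
  ext a b
  have : (r • M).submatrix a b = (r : ℂ) • M.submatrix a b := by ext; simp
  rw [Matrix.smul_apply, minorMat_apply, minorMat_apply, this, det_smul, Fintype.card_fin, Complex.real_smul]
  push_cast; ring

/-- The operator norm of the `k`-th compound matrix; for a positive semidefinite matrix this is
the product of the `k` largest eigenvalues. -/
noncomputable def compNorm (k : ℕ) (M : Matrix ι ι ℂ) : ℝ := ‖minorMat k M‖

theorem compNorm_nonneg (k : ℕ) (M : Matrix ι ι ℂ) : 0 ≤ compNorm k M := norm_nonneg _

theorem compNorm_mul_le (k : ℕ) (M N : Matrix ι ι ℂ) :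
    compNorm k (M * N) ≤ compNorm k M * compNorm k N := by
  rw [compNorm, minorMat_mul]; exact norm_mul_le _ _

theorem compNorm_star (k : ℕ) (M : Matrix ι ι ℂ) : compNorm k (star M) = compNorm k M := by
  rw [compNorm, star_eq_conjTranspose, minorMat_conjTranspose, l2_opNorm_conjTranspose, compNorm]

theorem compNorm_star_mul_self (k : ℕ) (M : Matrix ι ι ℂ) :
    compNorm k (star M * M) = compNorm k M ^ 2 := by
  rw [compNorm, star_eq_conjTranspose, minorMat_mul, minorMat_conjTranspose,
    l2_opNorm_conjTranspose_mul_self, compNorm, sq]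

theorem compNorm_smul (k : ℕ) {r : ℝ} (hr : 0 ≤ r) (M : Matrix ι ι ℂ) :
    compNorm k (r • M) = r ^ k * compNorm k M := by
  rw [compNorm, minorMat_smul, norm_smul, Real.norm_of_nonneg (pow_nonneg hr k), compNorm]

/-- The compound of 1 is a projection, not the identity: its norm x satisfies x = x². It vanishes
when k exceeds the size. -/
theorem compNorm_one_le (k : ℕ) : compNorm k (1 : Matrix ι ι ℂ) ≤ 1 := by
  have h := compNorm_star_mul_self k (1 : Matrix ι ι ℂ)
  rw [star_one, mul_one] at h
  by_contra! hlt
  exact absurd h (lt_self_pow₀ hlt one_lt_two).ne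

theorem compNorm_unitary_le (k : ℕ) {U : Matrix ι ι ℂ} (hU : U ∈ unitary (Matrix ι ι ℂ)) :
    compNorm k U ≤ 1 := by
  have h := compNorm_star_mul_self k U
  rw [Unitary.star_mul_self_of_mem hU] at h
  rw [← sq_le_one_iff₀ (compNorm_nonneg k U), ← h]
  exact compNorm_one_le k

theorem compNorm_unitary_conj_le (k : ℕ) {U : Matrix ι ι ℂ} (hU : U ∈ unitary (Matrix ι ι ℂ))
    (M : Matrix ι ι ℂ) : compNorm k (U * M * star U) ≤ compNorm k M := by
  have h1 := compNorm_unitary_le k hU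
  have h2 : compNorm k (star U) ≤ 1 := by rwa [compNorm_star]
  refine (compNorm_mul_le k (U * M) (star U)).trans ?_
  refine (mul_le_of_le_one_right (compNorm_nonneg k _) h2).trans ?_
  exact (compNorm_mul_le k U M).trans (mul_le_of_le_one_left (compNorm_nonneg k M) h1)

theorem compNorm_unitary_conj (k : ℕ) {U : Matrix ι ι ℂ} (hU : U ∈ unitary (Matrix ι ι ℂ))
    (M : Matrix ι ι ℂ) : compNorm k (U * M * star U) = compNorm k M := by
  have h := @compNorm_unitary_conj_le ι _ _ k
  refine le_antisymm (h hU M) ?_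
  have := h (Unitary.star_mem hU) (U * M * star U)
  rw [star_star] at this
  have e : star U * (U * M * star U) * U = M := by
    calc _ = (star U * U) * M * (star U * U) := by simp only [mul_assoc]
      _ = M := by rw [Unitary.star_mul_self_of_mem hU, one_mul, mul_one]
  rwa [e] at this

theorem minorMat_diagonal (k : ℕ) (d : ι → ℂ) :
    minorMat k (diagonal d) = minorMat k (1 : Matrix ι ι ℂ) * diagonal fun a => ∏ i, d (a i) := by
  ext a b
  rw [mul_diagonal, minorMat_apply, minorMat_apply, mul_assoc, mul_comm (det _),
    ← det_mul_row (fun i => d (b i))]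
  congr 2
  ext i j
  simp only [submatrix_apply, diagonal_apply, one_apply, of_apply]
  split_ifs with h
  · rw [h, mul_one]
  · rw [mul_zero]

omit [Fintype ι] in
theorem minorMat_one_apply_of_not_injective {k : ℕ} {a : Fin k → ι} (ha : ¬ Function.Injective a)
    (b : Fin k → ι) : minorMat k (1 : Matrix ι ι ℂ) b a = 0 := by
  simp only [Function.Injective, not_forall] at ha
  obtain ⟨i, j, hij, hne⟩ := ha
  rw [minorMat_apply, det_zero_of_column_eq hne fun l =>
    congrArg (fun t => (1 : Matrix ι ι ℂ) (b l) t) hij, mul_zero]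

/-- The antisymmetric projection kills tuples with a repeated index, so only injective tuples
contribute to the norm. -/
theorem compNorm_diagonal_le (k : ℕ) (d : ι → ℂ) {c : ℝ} (hc : 0 ≤ c)
    (h : ∀ a : Fin k → ι, Function.Injective a → ‖∏ i, d (a i)‖ ≤ c) :
    compNorm k (diagonal d) ≤ c := by
  classical
  have e : minorMat k (diagonal d) = minorMat k (1 : Matrix ι ι ℂ) *
      diagonal fun a => if Function.Injective a then ∏ i, d (a i) else 0 := by
    rw [minorMat_diagonal]
    ext b a
    rw [mul_diagonal, mul_diagonal]
    split_ifs with ha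
    · rfl
    · rw [minorMat_one_apply_of_not_injective ha, zero_mul, zero_mul]
  rw [compNorm, e]
  refine (norm_mul_le _ _).trans ?_
  rw [l2_opNorm_diagonal]
  have h1 : ‖minorMat k (1 : Matrix ι ι ℂ)‖ ≤ 1 := compNorm_one_le k
  have h2 : ‖fun a : Fin k → ι => if Function.Injective a then ∏ i, d (a i) else 0‖ ≤ c := by
    rw [pi_norm_le_iff_of_nonneg hc]
    intro a
    split_ifs with ha
    · exact h a ha
    · simpa using hc
  calc _ ≤ 1 * c := mul_le_mul h1 h2 (norm_nonneg _) zero_le_one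
    _ = c := one_mul c

/-- Column a of the antisymmetric projection is an eigenvector with eigenvalue the product of the d
(a i); injectivity of a makes it nonzero. -/
theorem le_compNorm_diagonal {k : ℕ} (d : ι → ℂ) {a : Fin k → ι} (ha : Function.Injective a) :
    ‖∏ i, d (a i)‖ ≤ compNorm k (diagonal d) := by
  set V := minorMat k (1 : Matrix ι ι ℂ) * single a a 1 with hV
  have hV0 : 0 < ‖V‖ := by
    rw [norm_pos_iff]
    intro h0
    have := congrFun (congrFun h0 a) a
    rw [hV, mul_single_apply_same, minorMat_apply, submatrix_one a ha, det_one] at this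
    simp [Nat.factorial_ne_zero] at this
  have e : minorMat k (diagonal d) * V = (∏ i, d (a i)) • V := by
    rw [hV, ← mul_assoc, ← minorMat_mul, mul_one, minorMat_diagonal, mul_assoc, ← mul_smul_comm]
    congr 1
    ext b c
    rw [diagonal_mul, Matrix.smul_apply, single_apply]
    split_ifs with hbc
    · rw [← hbc.1, smul_eq_mul]
    · simp
  have h := norm_mul_le (minorMat k (diagonal d)) V
  rw [e, norm_smul] at h
  exact le_of_mul_le_mul_right h hV0

theorem prod_filter_lt_eq {N k : ℕ} (hk : k ≤ N) (μ : Fin N → ℝ) :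
    ∏ i : Fin N with i.val < k, μ i = ∏ i : Fin k, μ (Fin.castLE hk i) := by
  symm
  refine Finset.prod_bij (fun i _ => Fin.castLE hk i) (fun i _ => by simp) (fun i _ j _ h => by
    simpa using h) (fun j hj => ?_) fun _ _ => rfl
  exact ⟨⟨j, by simpa using hj⟩, by simp, by simp⟩

/-- Listing the image of a in increasing order, the entry at position i is at least i, and μ is
decreasing. -/
theorem prod_injective_le {N k : ℕ} (hk : k ≤ N) {μ : Fin N → ℝ} (hμ : Antitone μ)
    (h0 : ∀ i, 0 ≤ μ i) {a : Fin k → Fin N} (ha : Function.Injective a) :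
    ∏ i, μ (a i) ≤ ∏ i : Fin N with i.val < k, μ i := by
  classical
  rw [prod_filter_lt_eq hk]
  set s : Finset (Fin N) := Finset.univ.image a with hs
  have hcard : s.card = k := by
    rw [hs, Finset.card_image_of_injective _ ha, Finset.card_univ, Fintype.card_fin]
  have e1 : ∏ i, μ (a i) = ∏ j ∈ s, μ j := by
    rw [hs, Finset.prod_image fun i _ j _ h => ha h]
  have e2 : ∏ j ∈ s, μ j = ∏ i : Fin k, μ (s.orderEmbOfFin hcard i) := by
    rw [← Finset.prod_image (s := Finset.univ) (g := s.orderEmbOfFin hcard)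
      fun i _ j _ h => (s.orderEmbOfFin hcard).injective h, Finset.image_orderEmbOfFin_univ]
  rw [e1, e2]
  refine Finset.prod_le_prod (fun i _ => h0 _) fun i _ => hμ ?_
  have : ∀ n (hn : n < k), n ≤ (s.orderEmbOfFin hcard ⟨n, hn⟩).val := by
    intro n
    induction n with
    | zero => intro _; exact Nat.zero_le _
    | succ n ih =>
      intro hn
      have h1 := ih (by omega)
      have h2 : s.orderEmbOfFin hcard ⟨n, by omega⟩ < s.orderEmbOfFin hcard ⟨n + 1, hn⟩ :=
        (s.orderEmbOfFin hcard).strictMono (by simp [Fin.lt_def])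
      rw [Fin.lt_def] at h2
      omega
  exact this i.val i.isLt

/-- The permutation r sorts the values of g decreasingly: the identity serves increasing g, the
reversal decreasing g. -/
theorem compNorm_cfc {k : ℕ} (hk : k ≤ Fintype.card ι) {H : Matrix ι ι ℂ} (hH : H.IsHermitian)
    (g : ℝ → ℝ) (r : Equiv.Perm (Fin (Fintype.card ι)))
    (hanti : Antitone fun i => g (hH.eigenvalues₀ (r i)))
    (h0 : ∀ i, 0 ≤ g (hH.eigenvalues₀ i)) :
    compNorm k (cfc g H) =
      ∏ i : Fin (Fintype.card ι) with i.val < k, g (hH.eigenvalues₀ (r i)) := by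
  set e : Fin (Fintype.card ι) ≃ ι := Fintype.equivOfCardEq (Fintype.card_fin _) with he
  have hev : ∀ i, hH.eigenvalues i = hH.eigenvalues₀ (e.symm i) := fun i => rfl
  rw [hH.cfc_eq, IsHermitian.cfc, Unitary.conjStarAlgAut_apply]
  have hnorm : ∀ a : Fin k → ι, ‖∏ i, (RCLike.ofReal ∘ g ∘ hH.eigenvalues : ι → ℂ) (a i)‖ =
      ∏ i, g (hH.eigenvalues₀ (e.symm (a i))) := fun a => by
    rw [norm_prod]
    refine Finset.prod_congr rfl fun i _ => ?_
    simp only [Function.comp_apply, hev]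
    rw [RCLike.norm_of_nonneg (h0 _)]
  have hconj := compNorm_unitary_conj k hH.eigenvectorUnitary.2
    (diagonal (RCLike.ofReal ∘ g ∘ hH.eigenvalues))
  refine hconj.trans (le_antisymm ?_ ?_)
  · refine compNorm_diagonal_le k _ (Finset.prod_nonneg fun i _ => h0 _) fun a ha => ?_
    rw [hnorm]
    have := prod_injective_le hk hanti (fun i => h0 _) (a := fun i => r.symm (e.symm (a i)))
      (r.symm.injective.comp (e.symm.injective.comp ha))
    simpa using this
  · have ha : Function.Injective fun i : Fin k => e (r (Fin.castLE hk i)) :=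
      e.injective.comp (r.injective.comp (Fin.castLE_injective hk))
    have h1 := le_compNorm_diagonal (RCLike.ofReal ∘ g ∘ hH.eigenvalues : ι → ℂ) ha
    rw [hnorm] at h1
    rw [prod_filter_lt_eq hk]
    simpa using h1

end Compound

/-! ### Araki's log-majorization -/

section Araki

open scoped MatrixOrder Matrix.Norms.L2Operator Nat
open Matrix

/-- If s were missing, the midpoint of the nearest points of E on either side of s would be a nearer
one. -/
theorem Icc_subset_of_midpoint_closed {E : Set ℝ} (hE : IsClosed E) (h0 : (0 : ℝ) ∈ E)
    (h1 : (1 : ℝ) ∈ E) (hmid : ∀ s ∈ E, ∀ t ∈ E, (s + t) / 2 ∈ E) : Set.Icc 0 1 ⊆ E := by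
  rintro s ⟨hs0, hs1⟩
  by_contra hs
  obtain ⟨a, ⟨haE, ha⟩, ha'⟩ := (isCompact_Icc.inter_left hE : IsCompact (E ∩ Set.Icc 0 s)).exists_isGreatest
    ⟨0, h0, le_refl _, hs0⟩
  obtain ⟨b, ⟨hbE, hb⟩, hb'⟩ := (isCompact_Icc.inter_left hE : IsCompact (E ∩ Set.Icc s 1)).exists_isLeast
    ⟨1, h1, hs1, le_refl _⟩
  have has : a < s := lt_of_le_of_ne ha.2 fun h => hs (h ▸ haE)
  have hbs : s < b := lt_of_le_of_ne hb.1 fun h => hs (h ▸ hbE)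
  have hm := hmid a haE b hbE
  rcases le_total ((a + b) / 2) s with h | h
  · have := ha' ⟨hm, by linarith [ha.1], h⟩
    linarith
  · have := hb' ⟨hm, h, by linarith [hb.2]⟩
    linarith

theorem le_of_forall_pow_two_pow_le {x y C : ℝ} (hy : 0 ≤ y)
    (h : ∀ n : ℕ, x ^ 2 ^ n ≤ C * y ^ 2 ^ n) : x ≤ y := by
  by_contra! hlt
  rcases hy.eq_or_lt with rfl | hy
  · have := h 0
    simp at this
    linarith
  · have hr : 1 < x / y := (one_lt_div hy).2 hlt
    obtain ⟨n, hn⟩ := pow_unbounded_of_one_lt C hr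
    have h1 : (x / y) ^ n ≤ (x / y) ^ 2 ^ n := pow_le_pow_right₀ hr.le n.lt_two_pow_self.le
    have h2 : (x / y) ^ 2 ^ n ≤ C := by
      rw [div_pow, div_le_iff₀ (pow_pos hy _)]; exact h n
    linarith

variable {ι : Type*} [Fintype ι] [DecidableEq ι]

theorem compNorm_pow_two_pow (k : ℕ) {H : Matrix ι ι ℂ} (hH : IsSelfAdjoint H) (n : ℕ) :
    compNorm k (H ^ 2 ^ n) = compNorm k H ^ 2 ^ n := by
  induction n with
  | zero => simp
  | succ n ih =>
    have h := compNorm_star_mul_self k (H ^ 2 ^ n)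
    rw [(hH.pow _).star_eq, ← pow_add, ← two_mul, ← pow_succ', ih, ← pow_mul, ← pow_succ] at h
    exact h

theorem compNorm_pow_le (k : ℕ) (M : Matrix ι ι ℂ) {n : ℕ} (hn : n ≠ 0) :
    compNorm k (M ^ n) ≤ compNorm k M ^ n := by
  induction n with
  | zero => exact absurd rfl hn
  | succ n ih =>
    rcases eq_or_ne n 0 with rfl | h
    · simp
    · rw [pow_succ, pow_succ]
      exact (compNorm_mul_le k _ _).trans
        (mul_le_mul_of_nonneg_right (ih h) (compNorm_nonneg k _))

/-- A spectral radius argument: H^N = g W^N h, and on the powers N = 2^n of a self-adjoint matrix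
the compound norm is multiplicative, so the constant from g and h disappears after taking N-th
roots. -/
theorem compNorm_le_of_similar (k : ℕ) {H W g h : Matrix ι ι ℂ} (hH : IsSelfAdjoint H)
    (hgh : h * g = 1) (e : H = g * W * h) : compNorm k H ≤ compNorm k W := by
  refine le_of_forall_pow_two_pow_le (C := compNorm k g * compNorm k h) (compNorm_nonneg k _)
    fun n => ?_
  have hp : ∀ n : ℕ, H ^ (n + 1) = g * W ^ (n + 1) * h := by
    intro n
    induction n with
    | zero => simpa using e
    | succ n ih =>
      rw [pow_succ, ih]
      calc g * W ^ (n + 1) * h * H = g * W ^ (n + 1) * h * (g * W * h) := by rw [e]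
        _ = g * W ^ (n + 1) * (h * g) * W * h := by simp only [mul_assoc]
        _ = _ := by rw [hgh, mul_one, pow_succ W (n + 1)]; simp only [mul_assoc]
  obtain ⟨l, hl⟩ : ∃ l, 2 ^ n = l + 1 := ⟨2 ^ n - 1, by have := Nat.two_pow_pos n; omega⟩
  rw [← compNorm_pow_two_pow k hH, hl, hp, ← hl]
  refine (compNorm_mul_le k _ _).trans ?_
  refine (mul_le_mul_of_nonneg_right (compNorm_mul_le k _ _) (compNorm_nonneg k _)).trans ?_
  have h1 := compNorm_pow_le k W (n := 2 ^ n) (by positivity)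
  calc compNorm k g * compNorm k (W ^ 2 ^ n) * compNorm k h
      = compNorm k g * compNorm k h * compNorm k (W ^ 2 ^ n) := by ring
    _ ≤ _ := mul_le_mul_of_nonneg_left h1
      (mul_nonneg (compNorm_nonneg k _) (compNorm_nonneg k _))

/-- With u = (s+t)/2, the matrix Y^u X^{2u} Y^u is similar, through a power of Y, to (X^s Y^s)* (X^t
Y^t). -/
theorem compNorm_rpow_mul_midpoint (k : ℕ) {X Y : Matrix ι ι ℂ} (hX : IsStrictlyPositive X)
    (hY : IsStrictlyPositive Y) (s t : ℝ) :
    compNorm k (X ^ ((s + t) / 2) * Y ^ ((s + t) / 2)) ^ 2 ≤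
      compNorm k (X ^ s * Y ^ s) * compNorm k (X ^ t * Y ^ t) := by
  set u := (s + t) / 2 with hu
  rw [← compNorm_star_mul_self]
  have e : star (X ^ u * Y ^ u) * (X ^ u * Y ^ u) =
      Y ^ (u - s) * (star (X ^ s * Y ^ s) * (X ^ t * Y ^ t)) * Y ^ (s - u) := by
    simp only [star_mul, star_rpow]
    calc Y ^ u * X ^ u * (X ^ u * Y ^ u) = Y ^ u * (X ^ u * X ^ u) * Y ^ u := by
          simp only [mul_assoc]
      _ = (Y ^ (u - s) * Y ^ s) * (X ^ s * X ^ t) * (Y ^ t * Y ^ (s - u)) := by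
        simp only [hX.rpow_mul_rpow, hY.rpow_mul_rpow]
        rw [show u - s + s = u by ring, show u + u = s + t by rw [hu]; ring,
          show t + (s - u) = u by rw [hu]; ring]
      _ = _ := by simp only [mul_assoc]
  refine (compNorm_le_of_similar k (IsSelfAdjoint.star_mul_self _) ?_ e).trans ?_
  · rw [hY.rpow_mul_rpow, sub_add_sub_cancel, sub_self, CFC.rpow_zero Y hY.nonneg]
  · refine (compNorm_mul_le k _ _).trans ?_
    rw [compNorm_star]

omit [Fintype ι] [DecidableEq ι] in
theorem continuous_minorMat (k : ℕ) :
    Continuous (minorMat k : Matrix ι ι ℂ → Matrix (Fin k → ι) (Fin k → ι) ℂ) := by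
  refine continuous_matrix fun a b => ?_
  exact continuous_const.mul (Continuous.matrix_det (continuous_id.matrix_submatrix a b))

theorem continuous_compNorm (k : ℕ) : Continuous (compNorm k : Matrix ι ι ℂ → ℝ) :=
  (continuous_minorMat k).norm

theorem continuous_rpow_exponent {X : Matrix ι ι ℂ} (hX : IsStrictlyPositive X) :
    Continuous fun s : ℝ => X ^ s := by
  have hH : X.IsHermitian := hX.isSelfAdjoint
  have hpos : ∀ i, 0 < hH.eigenvalues i := fun i =>
    hX.spectrum_pos (hH.eigenvalues_mem_spectrum_real i)
  have e : ∀ s : ℝ, X ^ s = (hH.eigenvectorUnitary : Matrix ι ι ℂ) *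
      diagonal (fun i => ((hH.eigenvalues i ^ s : ℝ) : ℂ)) *
      star (hH.eigenvectorUnitary : Matrix ι ι ℂ) := fun s => by
    rw [CFC.rpow_eq_cfc_real hX.nonneg]
    exact hH.cfc_eq _
  simp only [e]
  refine ((continuous_const (y := (hH.eigenvectorUnitary : Matrix ι ι ℂ))).mul
    (Continuous.matrix_diagonal (continuous_pi fun i => ?_))).mul
    continuous_const
  exact Complex.continuous_ofReal.comp (Real.continuous_const_rpow (hpos i).ne')

theorem one_le_compNorm_one {k : ℕ} (hk : k ≤ Fintype.card ι) :
    1 ≤ compNorm k (1 : Matrix ι ι ℂ) := by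
  have e : Fin (Fintype.card ι) ≃ ι := Fintype.equivOfCardEq (Fintype.card_fin _)
  have h := le_compNorm_diagonal (fun _ : ι => (1 : ℂ)) (a := fun i : Fin k => e (Fin.castLE hk i))
    (e.injective.comp (Fin.castLE_injective hk))
  simpa using h

theorem compNorm_pos {k : ℕ} (hk : k ≤ Fintype.card ι) {M : Matrix ι ι ℂ} (hM : IsUnit M) :
    0 < compNorm k M := by
  refine lt_of_le_of_ne (compNorm_nonneg k M) fun h => ?_
  have h1 := one_le_compNorm_one (ι := ι) hk
  have h2 := compNorm_mul_le k M (hM.unit⁻¹ : (Matrix ι ι ℂ)ˣ).val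
  rw [hM.mul_val_inv, ← h, zero_mul] at h2
  linarith

/-- The Araki–Cordes inequality for the products of the largest singular values. -/
theorem compNorm_rpow_mul_rpow_le {k : ℕ} (hk : k ≤ Fintype.card ι) {X Y : Matrix ι ι ℂ}
    (hX : IsStrictlyPositive X) (hY : IsStrictlyPositive Y) {s : ℝ} (h0 : 0 ≤ s) (h1 : s ≤ 1) :
    compNorm k (X ^ s * Y ^ s) ≤ compNorm k (X * Y) ^ s := by
  have hpos : 0 < compNorm k (X * Y) := compNorm_pos hk (hX.isUnit.mul hY.isUnit)
  -- The admissible exponents form a closed set containing 0 and 1, and the preceding estimate makes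
  -- it closed under midpoints.
  refine Icc_subset_of_midpoint_closed
    (E := {s : ℝ | compNorm k (X ^ s * Y ^ s) ≤ compNorm k (X * Y) ^ s}) ?_ ?_ ?_ ?_ ⟨h0, h1⟩
  · exact isClosed_le ((continuous_compNorm k).comp
      ((continuous_rpow_exponent hX).mul (continuous_rpow_exponent hY)))
      (Real.continuous_const_rpow hpos.ne')
  · simp only [Set.mem_ofPred_eq, CFC.rpow_zero X hX.nonneg, CFC.rpow_zero Y hY.nonneg, mul_one,
      Real.rpow_zero]
    exact compNorm_one_le k
  · simp only [Set.mem_ofPred_eq, CFC.rpow_one X hX.nonneg, CFC.rpow_one Y hY.nonneg,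
      Real.rpow_one, le_refl]
  · intro s hs t ht
    have h := compNorm_rpow_mul_midpoint k hX hY s t
    have h2 := h.trans (mul_le_mul hs ht (compNorm_nonneg k _) (Real.rpow_nonneg hpos.le _))
    rw [← Real.rpow_add hpos] at h2
    refine le_of_sq_le_sq ?_ (Real.rpow_nonneg hpos.le _)
    refine h2.trans_eq ?_
    rw [← Real.rpow_natCast, ← Real.rpow_mul hpos.le]
    congr 1
    push_cast; ring

theorem eigenvalues₀_mem_spectrum {H : Matrix ι ι ℂ} (hH : H.IsHermitian)
    (i : Fin (Fintype.card ι)) : hH.eigenvalues₀ i ∈ spectrum ℝ H := by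
  have := hH.eigenvalues_mem_spectrum_real (Fintype.equivOfCardEq (Fintype.card_fin _) i)
  simpa [IsHermitian.eigenvalues] using this

theorem compNorm_eq_prod {k : ℕ} (hk : k ≤ Fintype.card ι) {A : Matrix ι ι ℂ}
    (hA : A.PosSemidef) : compNorm k A =
      ∏ i : Fin (Fintype.card ι) with i.val < k, hA.isHermitian.eigenvalues₀ i := by
  have h := compNorm_cfc hk hA.isHermitian id (Equiv.refl _) hA.isHermitian.eigenvalues₀_antitone
    fun i => spectrum_nonneg_of_nonneg hA.nonneg (eigenvalues₀_mem_spectrum hA.isHermitian i)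
  exact (congrArg (compNorm k) (cfc_id ℝ A hA.isHermitian)).symm.trans h

theorem compNorm_rpow {k : ℕ} (hk : k ≤ Fintype.card ι) {A : Matrix ι ι ℂ}
    (hA : IsStrictlyPositive A) {s : ℝ} (hs : 0 ≤ s) :
    compNorm k (A ^ s) = compNorm k A ^ s := by
  have hA' : A.PosSemidef := hA.nonneg.posSemidef
  have h0 : ∀ i, 0 ≤ hA'.isHermitian.eigenvalues₀ i := fun i =>
    spectrum_nonneg_of_nonneg hA.nonneg (eigenvalues₀_mem_spectrum hA'.isHermitian i)
  rw [compNorm_eq_prod hk hA', CFC.rpow_eq_cfc_real hA.nonneg,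
    compNorm_cfc hk hA'.isHermitian (fun t => t ^ s) (Equiv.refl _)
      (fun i j hij => Real.rpow_le_rpow (h0 _) (hA'.isHermitian.eigenvalues₀_antitone hij) hs)
      (fun i => Real.rpow_nonneg (h0 i) _), ← Real.finsetProd_rpow _ _ fun i _ => h0 i]
  rfl

theorem compNorm_rpow_neg_one {k : ℕ} (hk : k ≤ Fintype.card ι) {A : Matrix ι ι ℂ}
    (hA : IsStrictlyPositive A) (hA' : A.PosSemidef) :
    compNorm k (A ^ (-1 : ℝ)) =
      (∏ i : Fin (Fintype.card ι) with i.val < k, hA'.isHermitian.eigenvalues₀ i.rev)⁻¹ := by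
  have h0 : ∀ i, 0 < hA'.isHermitian.eigenvalues₀ i := fun i =>
    hA.spectrum_pos (eigenvalues₀_mem_spectrum hA'.isHermitian i)
  rw [CFC.rpow_eq_cfc_real hA.nonneg,
    compNorm_cfc hk hA'.isHermitian (fun t => t ^ (-1 : ℝ)) Fin.revPerm
      (fun i j hij => Real.rpow_le_rpow_of_nonpos (h0 _)
        (hA'.isHermitian.eigenvalues₀_antitone (Fin.rev_le_rev.2 hij)) (by norm_num))
      (fun i => Real.rpow_nonneg (h0 i).le _), ← Finset.prod_inv_distrib]
  exact Finset.prod_congr rfl fun i _ => Real.rpow_neg_one _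

theorem compNorm_le_one {k : ℕ} (hk : k ≤ Fintype.card ι) {A : Matrix ι ι ℂ} (h0 : 0 ≤ A)
    (h1 : A ≤ 1) : compNorm k A ≤ 1 := by
  have hA : A.PosSemidef := h0.posSemidef
  rw [compNorm_eq_prod hk hA]
  refine Finset.prod_le_one (fun i _ => spectrum_nonneg_of_nonneg h0
    (eigenvalues₀_mem_spectrum hA.isHermitian i)) fun i _ => ?_
  have h2 : A ≤ algebraMap ℝ (Matrix ι ι ℂ) 1 := by rwa [map_one]
  exact (le_algebraMap_iff_spectrum_le hA.isHermitian.isSelfAdjoint).1 h2 _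
    (eigenvalues₀_mem_spectrum hA.isHermitian i)

/-- A = B^{1/2} K B^{1/2} with 0 ≤ K ≤ 1, and the compound norm is submultiplicative. -/
theorem compNorm_mono {k : ℕ} (hk : k ≤ Fintype.card ι) {A B : Matrix ι ι ℂ}
    (hA : IsStrictlyPositive A) (hAB : A ≤ B) : compNorm k A ≤ compNorm k B := by
  have hB := hA.of_le hAB
  set K := B ^ (-(1 / 2) : ℝ) * A * B ^ (-(1 / 2) : ℝ) with hK
  have hK0 : 0 ≤ K := (isStrictlyPositive_rpow_conj hB hA _).nonneg
  have hK1 : K ≤ 1 :=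
    (rpow_conj_le hAB B (-(1 / 2))).trans_eq (CFC.conjugate_rpow_neg_one_half B hB)
  have hB2 : compNorm k (B ^ (1 / 2 : ℝ)) ^ 2 = compNorm k B := by
    rw [← compNorm_star_mul_self, star_rpow, hB.rpow_mul_rpow]
    norm_num
    rw [CFC.rpow_one B hB.nonneg]
  calc compNorm k A = compNorm k (B ^ (1 / 2 : ℝ) * K * B ^ (1 / 2 : ℝ)) := by
        rw [hK, rpow_half_conj_neg_half hB]
    _ ≤ compNorm k (B ^ (1 / 2 : ℝ)) * compNorm k K * compNorm k (B ^ (1 / 2 : ℝ)) :=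
      (compNorm_mul_le k _ _).trans
        (mul_le_mul_of_nonneg_right (compNorm_mul_le k _ _) (compNorm_nonneg k _))
    _ ≤ compNorm k (B ^ (1 / 2 : ℝ)) * 1 * compNorm k (B ^ (1 / 2 : ℝ)) := by
      refine mul_le_mul_of_nonneg_right (mul_le_mul_of_nonneg_left (compNorm_le_one hk hK0 hK1)
        (compNorm_nonneg k _)) (compNorm_nonneg k _)
    _ = compNorm k B := by rw [mul_one, ← sq, hB2]

theorem compNorm_sandwich (k : ℕ) {X Y : Matrix ι ι ℂ} (hY : IsStrictlyPositive Y) (s : ℝ) :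
    compNorm k (X ^ (s / 2) * Y ^ s * X ^ (s / 2)) = compNorm k (Y ^ (s / 2) * X ^ (s / 2)) ^ 2 := by
  rw [← compNorm_star_mul_self, star_mul, star_rpow, star_rpow]
  congr 1
  calc _ = X ^ (s / 2) * (Y ^ (s / 2) * Y ^ (s / 2)) * X ^ (s / 2) := by
        rw [hY.rpow_mul_rpow, add_halves]
    _ = _ := by simp only [mul_assoc]

/-- Araki's log-majorization, for exponents in `[0, 1]`. -/
theorem araki_le {k : ℕ} (hk : k ≤ Fintype.card ι) {X Y : Matrix ι ι ℂ}
    (hX : IsStrictlyPositive X) (hY : IsStrictlyPositive Y) {s : ℝ} (h0 : 0 ≤ s) (h1 : s ≤ 1) :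
    compNorm k (X ^ (s / 2) * Y ^ s * X ^ (s / 2)) ≤
      compNorm k ((X ^ (1 / 2 : ℝ) * Y * X ^ (1 / 2 : ℝ)) ^ s) := by
  rw [compNorm_rpow hk (isStrictlyPositive_rpow_conj hX hY _) h0]
  have e := compNorm_sandwich k (X := X) hY 1
  rw [CFC.rpow_one Y hY.nonneg] at e
  rw [e, compNorm_sandwich k hY]
  have h := compNorm_rpow_mul_rpow_le hk (hY.rpow Y (1 / 2)) (hX.rpow X (1 / 2)) h0 h1
  rw [hX.rpow_rpow', hY.rpow_rpow', show 1 / 2 * s = s / 2 by ring] at h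
  calc _ ≤ (compNorm k (Y ^ (1 / 2 : ℝ) * X ^ (1 / 2 : ℝ)) ^ s) ^ 2 :=
        pow_le_pow_left₀ (compNorm_nonneg k _) h 2
    _ = _ := by
      rw [← Real.rpow_natCast, ← Real.rpow_natCast, ← Real.rpow_mul (compNorm_nonneg k _),
        ← Real.rpow_mul (compNorm_nonneg k _), mul_comm]

/-- Araki's log-majorization, for exponents at least `1`. -/
theorem araki_ge {k : ℕ} (hk : k ≤ Fintype.card ι) {X Y : Matrix ι ι ℂ}
    (hX : IsStrictlyPositive X) (hY : IsStrictlyPositive Y) {s : ℝ} (h1 : 1 ≤ s) :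
    compNorm k ((X ^ (1 / 2 : ℝ) * Y * X ^ (1 / 2 : ℝ)) ^ s) ≤
      compNorm k (X ^ (s / 2) * Y ^ s * X ^ (s / 2)) := by
  have hs : 0 < s := by linarith
  -- The case of exponent 1/s for X^s and Y^s; raising the result to the power s gives the claim.
  have h := araki_le hk (hX.rpow X s) (hY.rpow Y s) (s := s⁻¹) (inv_nonneg.2 hs.le)
    (inv_le_one_of_one_le₀ h1)
  simp only [hX.rpow_rpow', hY.rpow_rpow'] at h
  rw [mul_inv_cancel₀ hs.ne', show s * (s⁻¹ / 2) = 1 / 2 by field_simp,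
    show s * (1 / 2) = s / 2 by ring, CFC.rpow_one Y hY.nonneg,
    compNorm_rpow hk (isStrictlyPositive_rpow_conj hX (hY.rpow _ _) _) (inv_nonneg.2 hs.le)] at h
  rw [compNorm_rpow hk (isStrictlyPositive_rpow_conj hX hY _) hs.le]
  have h2 := Real.rpow_le_rpow (compNorm_nonneg k _) h hs.le
  rwa [← Real.rpow_mul (compNorm_nonneg k _), inv_mul_cancel₀ hs.ne', Real.rpow_one] at h2

theorem weakLogMaj_of_compNorm {A B : Matrix ι ι ℂ} (hA : 0 ≤ A) (hB : 0 ≤ B)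
    (h : ∀ k, k ≤ Fintype.card ι → compNorm k A ≤ compNorm k B) : WeakLogMaj A B := by
  refine ⟨hA.posSemidef, hB.posSemidef, fun k _ hk => ?_⟩
  rw [← compNorm_eq_prod hk hA.posSemidef, ← compNorm_eq_prod hk hB.posSemidef]
  exact h k hk

/-- The product of the k smallest eigenvalues is the reciprocal of the compound norm of the inverse.
-/
theorem logSupermaj_of_compNorm {A B : Matrix ι ι ℂ} (hA : IsStrictlyPositive A)
    (hB : IsStrictlyPositive B)
    (h : ∀ k, k ≤ Fintype.card ι → compNorm k (A ^ (-1 : ℝ)) ≤ compNorm k (B ^ (-1 : ℝ))) :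
    LogSupermaj A B := by
  refine ⟨hA.nonneg.posSemidef, hB.nonneg.posSemidef, fun k _ hk => ?_⟩
  have h1 := h k hk
  rw [compNorm_rpow_neg_one hk hA hA.nonneg.posSemidef,
    compNorm_rpow_neg_one hk hB hB.nonneg.posSemidef] at h1
  refine (inv_le_inv₀ ?_ ?_).1 h1 <;>
  refine Finset.prod_pos fun i _ => ?_
  · exact hA.spectrum_pos (eigenvalues₀_mem_spectrum hA.nonneg.posSemidef.isHermitian _)
  · exact hB.spectrum_pos (eigenvalues₀_mem_spectrum hB.nonneg.posSemidef.isHermitian _)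

end Araki

/-! ### From Loewner bounds to majorizations; the transposed perspective -/

section Majorization

open scoped MatrixOrder Matrix.Norms.L2Operator
open Matrix

theorem rpow_neg_one_sandwich {𝒜 : Type*} [CStarAlgebra 𝒜] [PartialOrder 𝒜] [StarOrderedRing 𝒜]
    {b y : 𝒜} (hb : IsStrictlyPositive b) (hy : IsStrictlyPositive y) (q : ℝ) :
    (b ^ q * y * b ^ q) ^ (-1 : ℝ) = (b ^ (-1 : ℝ)) ^ q * y ^ (-1 : ℝ) * (b ^ (-1 : ℝ)) ^ q := by
  rw [hb.rpow_rpow', neg_one_mul]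
  have hq := isStrictlyPositive_rpow_conj hb hy q
  have i1 : (b ^ q * y * b ^ q) * (b ^ (-q) * y ^ (-1 : ℝ) * b ^ (-q)) = 1 := by
    have t2 : y * y ^ (-1 : ℝ) = 1 := by
      have := CFC.rpow_mul_rpow_neg (1 : ℝ) hy
      rwa [CFC.rpow_one _ hy.nonneg] at this
    calc _ = b ^ q * (y * ((b ^ q * b ^ (-q)) * y ^ (-1 : ℝ))) * b ^ (-q) := by
          simp only [mul_assoc]
      _ = 1 := by rw [CFC.rpow_mul_rpow_neg q hb, one_mul, t2, mul_one, CFC.rpow_mul_rpow_neg q hb]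
  have i2 := CFC.rpow_neg_mul_rpow (1 : ℝ) hq
  rw [CFC.rpow_one _ hq.nonneg] at i2
  exact left_inv_eq_right_inv i2 i1

variable {ι : Type*} [Fintype ι] [DecidableEq ι] {Q R S b d : Matrix ι ι ℂ} {α s : ℝ}

theorem weakLogMaj_smul_of_le (hQ : IsStrictlyPositive Q) (hS : IsStrictlyPositive S)
    (hα : 0 < α) (h : Q ≤ α • R)
    (hRS : ∀ k, k ≤ Fintype.card ι → compNorm k R ≤ compNorm k S) : WeakLogMaj Q (α • S) :=
  weakLogMaj_of_compNorm hQ.nonneg (hS.smul hα).nonneg fun k hk => by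
    refine (compNorm_mono hk hQ h).trans ?_
    rw [compNorm_smul k hα.le, compNorm_smul k hα.le]
    exact mul_le_mul_of_nonneg_left (hRS k hk) (pow_nonneg hα.le k)

theorem smul_weakLogMaj_of_le (hR : IsStrictlyPositive R) (hS : IsStrictlyPositive S)
    (hα : 0 < α) (h : α • R ≤ Q)
    (hRS : ∀ k, k ≤ Fintype.card ι → compNorm k S ≤ compNorm k R) : WeakLogMaj (α • S) Q :=
  weakLogMaj_of_compNorm (hS.smul hα).nonneg ((hR.smul hα).nonneg.trans h) fun k hk => by
    refine le_trans ?_ (compNorm_mono hk (hR.smul hα) h)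
    rw [compNorm_smul k hα.le, compNorm_smul k hα.le]
    exact mul_le_mul_of_nonneg_left (hRS k hk) (pow_nonneg hα.le k)

theorem logSupermaj_smul_of_le (hR : IsStrictlyPositive R) (hS : IsStrictlyPositive S)
    (hα : 0 < α) (h : α • R ≤ Q)
    (hRS : ∀ k, k ≤ Fintype.card ι → compNorm k (R ^ (-1 : ℝ)) ≤ compNorm k (S ^ (-1 : ℝ))) :
    LogSupermaj Q (α • S) := by
  have hQ := (hR.smul hα).of_le h
  refine logSupermaj_of_compNorm hQ (hS.smul hα) fun k hk => ?_
  refine (compNorm_mono hk (hQ.rpow _ _)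
    (CStarAlgebra.rpow_neg_one_le_rpow_neg_one h (hR.smul hα))).trans ?_
  have hβ : 0 ≤ α ^ (-1 : ℝ) := Real.rpow_nonneg hα.le _
  rw [smul_rpow hR hα, smul_rpow hS hα, compNorm_smul k hβ, compNorm_smul k hβ]
  exact mul_le_mul_of_nonneg_left (hRS k hk) (pow_nonneg hβ k)

theorem smul_logSupermaj_of_le (hQ : IsStrictlyPositive Q) (hR : IsStrictlyPositive R)
    (hS : IsStrictlyPositive S) (hα : 0 < α) (h : Q ≤ α • R)
    (hRS : ∀ k, k ≤ Fintype.card ι → compNorm k (S ^ (-1 : ℝ)) ≤ compNorm k (R ^ (-1 : ℝ))) :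
    LogSupermaj (α • S) Q := by
  refine logSupermaj_of_compNorm (hS.smul hα) hQ fun k hk => ?_
  refine le_trans ?_ (compNorm_mono hk ((hR.smul hα).rpow _ _)
    (CStarAlgebra.rpow_neg_one_le_rpow_neg_one h hQ))
  have hβ : 0 ≤ α ^ (-1 : ℝ) := Real.rpow_nonneg hα.le _
  rw [smul_rpow hR hα, smul_rpow hS hα, compNorm_smul k hβ, compNorm_smul k hβ]
  exact mul_le_mul_of_nonneg_left (hRS k hk) (pow_nonneg hβ k)

theorem rpow_neg_one_rpow_comm (hb : IsStrictlyPositive b) (s : ℝ) :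
    (b ^ s) ^ (-1 : ℝ) = (b ^ (-1 : ℝ)) ^ s := by
  rw [hb.rpow_rpow', hb.rpow_rpow', mul_comm]

/-- Inversion turns both sides into the same expressions in b⁻¹ and d⁻¹. -/
theorem araki_inv_le {k : ℕ} (hk : k ≤ Fintype.card ι) (hb : IsStrictlyPositive b)
    (hd : IsStrictlyPositive d) (h0 : 0 ≤ s) (h1 : s ≤ 1) :
    compNorm k ((b ^ (s / 2) * d ^ s * b ^ (s / 2)) ^ (-1 : ℝ)) ≤
      compNorm k (((b ^ (1 / 2 : ℝ) * d * b ^ (1 / 2 : ℝ)) ^ s) ^ (-1 : ℝ)) := by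
  rw [rpow_neg_one_rpow_comm (isStrictlyPositive_rpow_conj hb hd _),
    rpow_neg_one_sandwich hb (hd.rpow _ _), rpow_neg_one_sandwich hb hd,
    rpow_neg_one_rpow_comm hd]
  exact araki_le hk (hb.rpow _ _) (hd.rpow _ _) h0 h1

theorem araki_inv_ge {k : ℕ} (hk : k ≤ Fintype.card ι) (hb : IsStrictlyPositive b)
    (hd : IsStrictlyPositive d) (h1 : 1 ≤ s) :
    compNorm k (((b ^ (1 / 2 : ℝ) * d * b ^ (1 / 2 : ℝ)) ^ s) ^ (-1 : ℝ)) ≤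
      compNorm k ((b ^ (s / 2) * d ^ s * b ^ (s / 2)) ^ (-1 : ℝ)) := by
  rw [rpow_neg_one_rpow_comm (isStrictlyPositive_rpow_conj hb hd _),
    rpow_neg_one_sandwich hb (hd.rpow _ _), rpow_neg_one_sandwich hb hd,
    rpow_neg_one_rpow_comm hd]
  exact araki_ge hk (hb.rpow _ _) (hd.rpow _ _) h1

theorem matPow_eq_rpow (hb : IsStrictlyPositive b) (q : ℝ) : matPow b q = b ^ q :=
  (CFC.rpow_eq_cfc_real hb.nonneg).symm

theorem relMat_eq (a : Matrix ι ι ℂ) (hb : IsStrictlyPositive b) :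
    relMat a b = b ^ (-(1 / 2) : ℝ) * a * b ^ (-(1 / 2) : ℝ) := by
  rw [relMat, matPow_eq_rpow hb]

theorem relMat_isStrictlyPositive {a : Matrix ι ι ℂ} (ha : IsStrictlyPositive a)
    (hb : IsStrictlyPositive b) : IsStrictlyPositive (relMat a b) := by
  rw [relMat_eq a hb]; exact isStrictlyPositive_rpow_conj hb ha _

theorem perspective_eq (f : ℝ → ℝ) (a : Matrix ι ι ℂ) (hb : IsStrictlyPositive b) :
    perspective f a b = b ^ (1 / 2 : ℝ) * cfc f (relMat a b) * b ^ (1 / 2 : ℝ) := by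
  rw [perspective, matPow_eq_rpow hb]

theorem perspective_isStrictlyPositive {f : ℝ → ℝ} (hc : ContinuousOn f (Set.Ioi 0))
    (hpos : ∀ t, 0 < t → 0 < f t) {a : Matrix ι ι ℂ} (ha : IsStrictlyPositive a)
    (hb : IsStrictlyPositive b) : IsStrictlyPositive (perspective f a b) := by
  rw [perspective_eq f a hb]
  exact isStrictlyPositive_rpow_conj hb
    (cfc_isStrictlyPositive hc hpos (relMat_isStrictlyPositive ha hb)) _

/-- The majorizations between `P_g(a^p, b^p)` and powers of `P_g(a, b)`, for arbitrary constants
bounding the ratio `g(t^p) / g(t)^p` and the matrix `P_g(a, b)`. -/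
theorem ActsDecreasing.perspective_majorization {g : ℝ → ℝ}
    (hg : ActsDecreasing (Matrix ι ι ℂ) g) {a : Matrix ι ι ℂ} (ha : IsStrictlyPositive a)
    (hb : IsStrictlyPositive b) {p K κ M μ : ℝ} (hK : 0 < K) (hκ : 0 < κ) (hM : 0 < M)
    (hμ : 0 < μ) (hKle : ∀ t ∈ spectrum ℝ (relMat a b), g (t ^ p) ≤ K * g t ^ p)
    (hκle : ∀ t ∈ spectrum ℝ (relMat a b), κ * g t ^ p ≤ g (t ^ p))
    (hPM : perspective g a b ≤ M • 1) (hPμ : μ • 1 ≤ perspective g a b) :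
    (1 / 2 ≤ p → p ≤ 1 →
      WeakLogMaj (perspective g (matPow a p) (matPow b p))
        ((K * M ^ (1 - p)) • matPow (perspective g a b) (2 * p - 1)) ∧
      LogSupermaj (perspective g (matPow a p) (matPow b p))
        ((κ * μ ^ (1 - p)) • matPow (perspective g a b) (2 * p - 1))) ∧
    (1 ≤ p → p ≤ 2 →
      WeakLogMaj ((κ * M ^ (1 - p)) • matPow (perspective g a b) (2 * p - 1))
        (perspective g (matPow a p) (matPow b p)) ∧
      LogSupermaj ((K * μ ^ (1 - p)) • matPow (perspective g a b) (2 * p - 1))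
        (perspective g (matPow a p) (matPow b p))) := by
  have hc := relMat_isStrictlyPositive ha hb
  have hd := cfc_isStrictlyPositive hg.continuousOn hg.pos hc
  have hP := perspective_isStrictlyPositive hg.continuousOn hg.pos ha hb
  have hQ := perspective_isStrictlyPositive hg.continuousOn hg.pos (ha.rpow a p) (hb.rpow b p)
  have hS := hP.rpow _ (2 * p - 1)
  have hR := isStrictlyPositive_rpow_conj hb (hd.rpow _ (2 * p - 1)) ((2 * p - 1) / 2)
  have eQ := perspective_eq g (a ^ p) (hb.rpow b p)
  rw [relMat_eq (a ^ p) (hb.rpow b p)] at eQ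
  have eP := perspective_eq g a hb
  have hcd := relMat_eq a hb
  rw [matPow_eq_rpow hP, matPow_eq_rpow ha, matPow_eq_rpow hb]
  have hMp : 0 < M ^ (1 - p) := Real.rpow_pos_of_pos hM _
  have hμp : 0 < μ ^ (1 - p) := Real.rpow_pos_of_pos hμ _
  rw [eP] at hPM hPμ
  -- Each part combines one Loewner bound with Araki at s = 2p - 1, which lies in [0,1] for 1/2 ≤ p
  -- ≤ 1 and is at least 1 for p ≥ 1. Upper bounds use M for p ≤ 1 and μ for p ≥ 1, lower bounds the
  -- opposite.
  refine ⟨fun h0 h1 => ⟨?_, ?_⟩, fun h0 h1 => ⟨?_, ?_⟩⟩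
  · have h := hg.perspective_le (p := p) (K := K) ha hb hM hcd
      (Or.inl ⟨by linarith, h1, hPM⟩) hKle
    rw [← eQ] at h
    refine weakLogMaj_smul_of_le hQ hS (mul_pos hK hMp) h fun k hk => ?_
    rw [eP]
    exact araki_le hk hb hd (by linarith) (by linarith)
  · have h := hg.le_perspective (p := p) (K := κ) ha hb hμ hcd
      (Or.inl ⟨by linarith, h1, hPμ⟩) hκle
    rw [← eQ] at h
    refine logSupermaj_smul_of_le hR hS (mul_pos hκ hμp) h fun k hk => ?_
    rw [eP]
    exact araki_inv_le hk hb hd (by linarith) (by linarith)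
  · have h := hg.le_perspective (p := p) (K := κ) ha hb hM hcd
      (Or.inr ⟨h0, h1, hPM⟩) hκle
    rw [← eQ] at h
    refine smul_weakLogMaj_of_le hR hS (mul_pos hκ hMp) h fun k hk => ?_
    rw [eP]
    exact araki_ge hk hb hd (by linarith)
  · have h := hg.perspective_le (p := p) (K := K) ha hb hμ hcd
      (Or.inr ⟨h0, h1, hPμ⟩) hKle
    rw [← eQ] at h
    refine smul_logSupermaj_of_le hQ hR hS (mul_pos hK hμp) h fun k hk => ?_
    rw [eP]
    exact araki_inv_ge hk hb hd (by linarith)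

theorem powRatio_eq_cfc {f : ℝ → ℝ} (hf : ContinuousOn f (Set.Ioi 0))
    (hpos : ∀ t, 0 < t → 0 < f t) {c : Matrix ι ι ℂ} (hc : IsStrictlyPositive c) (p : ℝ) :
    powRatio f c p = cfc (fun t => f (t ^ p) * f t ^ (-p)) c := by
  have hd := cfc_isStrictlyPositive hf hpos hc
  have hinv : (matPow (cfc f c) p)⁻¹ = cfc f c ^ (-p) := by
    refine Matrix.inv_eq_right_inv ?_
    rw [matPow_eq_rpow hd]
    exact CFC.rpow_mul_rpow_neg p hd
  have h1 : ContinuousOn (fun t : ℝ => f (t ^ p)) (Set.Ioi 0) :=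
    hf.comp (continuousOn_rpow_Ioi p) fun t ht => Real.rpow_pos_of_pos ht p
  rw [powRatio, hinv, matPow_eq_rpow hc]
  have h2 := cfc_mul_cfc_of_pos h1 (continuousOn_rpow_comp hf hpos (-p)) hc
  rw [← rpow_cfc_of_pos hf hpos hc, ← cfc_rpow_of_pos hf hc] at h2
  exact h2

theorem powRatio_isStrictlyPositive {f : ℝ → ℝ} (hf : ContinuousOn f (Set.Ioi 0))
    (hpos : ∀ t, 0 < t → 0 < f t) {c : Matrix ι ι ℂ} (hc : IsStrictlyPositive c) (p : ℝ) :
    IsStrictlyPositive (powRatio f c p) := by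
  rw [powRatio_eq_cfc hf hpos hc]
  refine cfc_isStrictlyPositive ((hf.comp (continuousOn_rpow_Ioi p) fun t ht =>
    Real.rpow_pos_of_pos ht p).mul (continuousOn_rpow_comp hf hpos (-p))) (fun t ht => ?_) hc
  exact mul_pos (hpos _ (Real.rpow_pos_of_pos ht p)) (Real.rpow_pos_of_pos (hpos t ht) _)

theorem le_opNorm_smul_one (hb : IsStrictlyPositive b) : b ≤ opNorm b • (1 : Matrix ι ι ℂ) := by
  have := hb.isSelfAdjoint.le_algebraMap_norm_self
  rwa [Algebra.algebraMap_eq_smul_one] at this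

theorem lambdaMin_le (b : Matrix ι ι ℂ) {t : ℝ} (ht : t ∈ spectrum ℝ b) : lambdaMin b ≤ t :=
  csInf_le b.finite_real_spectrum.bddBelow ht

theorem lambdaMin_smul_one_le (hb : IsStrictlyPositive b) :
    lambdaMin b • (1 : Matrix ι ι ℂ) ≤ b := by
  rw [← Algebra.algebraMap_eq_smul_one, algebraMap_le_iff_le_spectrum hb.isSelfAdjoint]
  exact fun t ht => lambdaMin_le b ht

theorem le_opNorm (hb : IsStrictlyPositive b) {t : ℝ} (ht : t ∈ spectrum ℝ b) : t ≤ opNorm b := by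
  have h := le_opNorm_smul_one hb
  rw [← Algebra.algebraMap_eq_smul_one, le_algebraMap_iff_spectrum_le hb.isSelfAdjoint] at h
  exact h t ht

theorem lambdaMin_pos [Nonempty ι] (hb : IsStrictlyPositive b) : 0 < lambdaMin b := by
  have hne : (spectrum ℝ b).Nonempty :=
    ContinuousFunctionalCalculus.spectrum_nonempty b hb.isSelfAdjoint
  exact hb.spectrum_pos (hne.csInf_mem b.finite_real_spectrum)

theorem opNorm_pos [Nonempty ι] (hb : IsStrictlyPositive b) : 0 < opNorm b := by
  obtain ⟨t, ht⟩ : (spectrum ℝ b).Nonempty :=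
    ContinuousFunctionalCalculus.spectrum_nonempty b hb.isSelfAdjoint
  exact (hb.spectrum_pos ht).trans_le (le_opNorm hb ht)

/-- By spectral mapping, f(t^p) f(t)^{-p} is an eigenvalue of the ratio matrix. -/
theorem powRatio_bounds {f : ℝ → ℝ} (hf : ContinuousOn f (Set.Ioi 0))
    (hpos : ∀ t, 0 < t → 0 < f t) {c : Matrix ι ι ℂ} (hc : IsStrictlyPositive c) (p : ℝ) {t : ℝ}
    (ht : t ∈ spectrum ℝ c) :
    f (t ^ p) ≤ opNorm (powRatio f c p) * f t ^ p ∧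
      lambdaMin (powRatio f c p) * f t ^ p ≤ f (t ^ p) := by
  have hr := powRatio_isStrictlyPositive hf hpos hc p
  have hft := hpos t (hc.spectrum_pos ht)
  have hmem : f (t ^ p) * f t ^ (-p) ∈ spectrum ℝ (powRatio f c p) := by
    rw [powRatio_eq_cfc hf hpos hc]
    have h := cfc_map_spectrum (R := ℝ) (fun t => f (t ^ p) * f t ^ (-p)) c hc.isSelfAdjoint
      (c.finite_real_spectrum.continuousOn _)
    exact h ▸ Set.mem_image_of_mem _ ht
  have hp := Real.rpow_pos_of_pos hft p
  have e : f (t ^ p) * f t ^ (-p) * f t ^ p = f (t ^ p) := by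
    rw [mul_assoc, ← Real.rpow_add hft, neg_add_cancel, Real.rpow_zero, mul_one]
  constructor
  · calc f (t ^ p) = f (t ^ p) * f t ^ (-p) * f t ^ p := e.symm
      _ ≤ _ := mul_le_mul_of_nonneg_right (le_opNorm hr hmem) hp.le
  · calc _ ≤ f (t ^ p) * f t ^ (-p) * f t ^ p :=
          mul_le_mul_of_nonneg_right (lambdaMin_le _ hmem) hp.le
      _ = _ := e

/-- With `x = b^{-1/2} a^{1/2}`, `C = x x*` and the transposed relative matrix is `(x* x)⁻¹`. -/
theorem exists_relMat_factor {a : Matrix ι ι ℂ} (ha : IsStrictlyPositive a)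
    (hb : IsStrictlyPositive b) : ∃ x : Matrix ι ι ℂ, IsUnit x ∧ relMat a b = x * star x ∧
      (relMat b a) ^ (-1 : ℝ) = star x * x ∧ b ^ (1 / 2 : ℝ) * x = a ^ (1 / 2 : ℝ) := by
  refine ⟨b ^ (-(1 / 2) : ℝ) * a ^ (1 / 2 : ℝ),
    (hb.rpow _ _).isUnit.mul (ha.rpow _ _).isUnit, ?_, ?_, ?_⟩
  · rw [relMat_eq a hb, star_mul, star_rpow, star_rpow]
    calc _ = b ^ (-(1 / 2) : ℝ) * (a ^ (1 / 2 : ℝ) * a ^ (1 / 2 : ℝ)) * b ^ (-(1 / 2) : ℝ) := by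
          rw [ha.rpow_mul_rpow, add_halves, CFC.rpow_one a ha.nonneg]
      _ = _ := by simp only [mul_assoc]
  · rw [relMat_eq b ha, rpow_neg_one_sandwich ha hb, ha.rpow_rpow', star_mul, star_rpow, star_rpow]
    rw [show (-1 : ℝ) * -(1 / 2) = 1 / 2 by ring]
    calc _ = a ^ (1 / 2 : ℝ) * (b ^ (-(1 / 2) : ℝ) * b ^ (-(1 / 2) : ℝ)) * a ^ (1 / 2 : ℝ) := by
          rw [hb.rpow_mul_rpow]; norm_num
      _ = _ := by simp only [mul_assoc]
  · rw [← mul_assoc, CFC.rpow_mul_rpow_neg _ hb, one_mul]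

/-- With x = b^{-1/2} a^{1/2} and w = (x*x)⁻¹, the transposed function takes w to w f(x*x). Since
a^{1/2} = b^{1/2} x, the intertwining f(x*x) x* = x* f(xx*) and x w x* = 1 leave b^{1/2} f(xx*)
b^{1/2}. -/
theorem perspective_transposeFun {f : ℝ → ℝ} (hf : ContinuousOn f (Set.Ioi 0))
    {a : Matrix ι ι ℂ} (ha : IsStrictlyPositive a) (hb : IsStrictlyPositive b) :
    perspective (transposeFun f) b a = perspective f a b := by
  obtain ⟨x, hx, h1, h2, h3⟩ := exists_relMat_factor ha hb
  have hw := relMat_isStrictlyPositive hb ha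
  have hxx := hx.isStrictlyPositive_star_mul_self
  set w := relMat b a with hwdef
  have ew : w = (star x * x) ^ (-1 : ℝ) := by
    rw [← h2, hw.rpow_rpow']; norm_num; exact (CFC.rpow_one w hw.nonneg).symm
  have h3' : star x * b ^ (1 / 2 : ℝ) = a ^ (1 / 2 : ℝ) := by
    have := congrArg star h3
    rwa [star_mul, star_rpow, star_rpow] at this
  rw [perspective_eq _ b ha, perspective_eq _ a hb, ← hwdef]
  have e1 : cfc (transposeFun f) w = w * cfc f (star x * x) := by
    rw [← h2, cfc_rpow_of_pos hf hw]
    have hfi : ContinuousOn (fun t : ℝ => f (t ^ (-1 : ℝ))) (Set.Ioi 0) :=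
      hf.comp (continuousOn_rpow_Ioi (-1)) fun _ ht => Real.rpow_pos_of_pos ht _
    have h := cfc_mul_cfc_of_pos continuousOn_id hfi hw
    rw [cfc_id ℝ w hw.isSelfAdjoint] at h
    exact h.symm
  have e2 : cfc f (star x * x) * star x = star x * cfc f (x * star x) := by
    have h := congrArg star (cfc_mul_star_self f hx hf)
    have s1 : star (cfc f (x * star x)) = cfc f (x * star x) :=
      IsSelfAdjoint.cfc (f := f) (a := x * star x)
    have s2 : star (cfc f (star x * x)) = cfc f (star x * x) :=
      IsSelfAdjoint.cfc (f := f) (a := star x * x)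
    rw [star_mul, star_mul, s1, s2] at h
    exact h.symm
  have e3 : x * w * star x = 1 := by
    refine hx.mul_right_cancel ?_
    have h := CFC.rpow_neg_mul_rpow (1 : ℝ) hxx
    rw [CFC.rpow_one _ hxx.nonneg, ← ew] at h
    rw [one_mul, mul_assoc, mul_assoc, h, mul_one]
  rw [e1, h1]
  calc _ = (b ^ (1 / 2 : ℝ) * x) * (w * cfc f (star x * x)) * (star x * b ^ (1 / 2 : ℝ)) := by
        rw [h3, h3']
    _ = b ^ (1 / 2 : ℝ) * (x * w * (cfc f (star x * x) * star x)) * b ^ (1 / 2 : ℝ) := by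
        simp only [mul_assoc]
    _ = b ^ (1 / 2 : ℝ) * (x * w * star x * cfc f (x * star x)) * b ^ (1 / 2 : ℝ) := by
        rw [e2]; simp only [mul_assoc]
    _ = _ := by rw [e3, one_mul]

theorem inv_mem_spectrum_relMat {a : Matrix ι ι ℂ} (ha : IsStrictlyPositive a)
    (hb : IsStrictlyPositive b) {t : ℝ} (ht : t ∈ spectrum ℝ (relMat b a)) :
    t ^ (-1 : ℝ) ∈ spectrum ℝ (relMat a b) := by
  obtain ⟨x, hx, h1, h2, -⟩ := exists_relMat_factor ha hb
  have hw := relMat_isStrictlyPositive hb ha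
  rw [h1, spectrum_mul_star_self hx, ← h2, ← matPow_eq_rpow hw, matPow]
  have h := cfc_map_spectrum (R := ℝ) (fun t => t ^ (-1 : ℝ)) (relMat b a) hw.isSelfAdjoint
    ((relMat b a).finite_real_spectrum.continuousOn _)
  exact h ▸ Set.mem_image_of_mem _ ht

end Majorization

/-! ### The two cases of the theorem -/

theorem proposition3p13 (f : ℝ → ℝ)
    (hf : IsOMD1 f ∨ (IsOC1 f ∧ Tendsto f (𝓝[>] 0) (𝓝 0)))
    (n : ℕ) (A B : Matrix (Fin n) (Fin n) ℂ) (hA : A.PosDef) (hB : B.PosDef) (p : ℝ) :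
    (1 / 2 ≤ p → p ≤ 1 →
      WeakLogMaj (perspective f (matPow A p) (matPow B p))
        ((opNorm (powRatio f (relMat A B) p) * opNorm (perspective f A B) ^ (1 - p)) •
          matPow (perspective f A B) (2 * p - 1)) ∧
      LogSupermaj (perspective f (matPow A p) (matPow B p))
        ((lambdaMin (powRatio f (relMat A B) p) * lambdaMin (perspective f A B) ^ (1 - p)) •
          matPow (perspective f A B) (2 * p - 1))) ∧
    (1 ≤ p → p ≤ 2 →
      WeakLogMaj
        ((lambdaMin (powRatio f (relMat A B) p) * opNorm (perspective f A B) ^ (1 - p)) •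
          matPow (perspective f A B) (2 * p - 1))
        (perspective f (matPow A p) (matPow B p)) ∧
      LogSupermaj
        ((opNorm (powRatio f (relMat A B) p) * lambdaMin (perspective f A B) ^ (1 - p)) •
          matPow (perspective f A B) (2 * p - 1))
        (perspective f (matPow A p) (matPow B p))) := by
  open scoped MatrixOrder Matrix.Norms.L2Operator in
  -- In size 0 the spectrum is empty and `lambdaMin` takes the default value 0, so the constants are
  -- not positive; but no k with 1 ≤ k ≤ 0 exists.
  rcases isEmpty_or_nonempty (Fin n) with he | hne
  · have hpsd : ∀ X : Matrix (Fin n) (Fin n) ℂ, X.PosSemidef := fun X => by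
      rw [Subsingleton.elim X 0]; exact .zero
    have hW : ∀ X Y : Matrix (Fin n) (Fin n) ℂ, WeakLogMaj X Y := fun X Y =>
      ⟨hpsd X, hpsd Y, fun k h1 hk => by rw [Fintype.card_eq_zero] at hk; omega⟩
    have hL : ∀ X Y : Matrix (Fin n) (Fin n) ℂ, LogSupermaj X Y := fun X Y =>
      ⟨hpsd X, hpsd Y, fun k h1 hk => by rw [Fintype.card_eq_zero] at hk; omega⟩
    exact ⟨fun _ _ => ⟨hW _ _, hL _ _⟩, fun _ _ => ⟨hW _ _, hL _ _⟩⟩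
  have ha := Matrix.isStrictlyPositive_iff_posDef.2 hA
  have hb := Matrix.isStrictlyPositive_iff_posDef.2 hB
  have hfc : ContinuousOn f (Set.Ioi 0) ∧ ∀ t, 0 < t → 0 < f t := by
    rcases hf with hf | ⟨hf, -⟩
    · exact ⟨(hf.actsDecreasing (Fin n)).continuousOn, hf.pos⟩
    · exact ⟨hf.convex.1, hf.pos⟩
  obtain ⟨hc, hpos⟩ := hfc
  have hC := relMat_isStrictlyPositive ha hb
  have hr := powRatio_isStrictlyPositive hc hpos hC p
  have hP := perspective_isStrictlyPositive hc hpos ha hb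
  have hPM := le_opNorm_smul_one hP
  have hPμ := lambdaMin_smul_one_le hP
  rcases hf with hf | ⟨hf, h0⟩
  · exact (hf.actsDecreasing (Fin n)).perspective_majorization ha hb (opNorm_pos hr)
      (lambdaMin_pos hr) (opNorm_pos hP) (lambdaMin_pos hP)
      (fun t ht => (powRatio_bounds hc hpos hC p ht).1)
      (fun t ht => (powRatio_bounds hc hpos hC p ht).2) hPM hPμ
  -- Case (b): the majorization for decreasing functions is applied to the transpose of f, with A
  -- and B exchanged.
  · have e := perspective_transposeFun hc ha hb
    have ep : perspective (transposeFun f) (matPow B p) (matPow A p) =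
        perspective f (matPow A p) (matPow B p) := by
      rw [matPow_eq_rpow ha, matPow_eq_rpow hb]
      exact perspective_transposeFun hc (ha.rpow A p) (hb.rpow B p)
    rw [← e] at hP hPM hPμ
    -- The factors t^p cancel, so the ratio for the transpose at t is that for f at 1/t, and the
    -- same constants serve.
    have hbd : ∀ t ∈ spectrum ℝ (relMat B A),
        transposeFun f (t ^ p) ≤ opNorm (powRatio f (relMat A B) p) * transposeFun f t ^ p ∧
        lambdaMin (powRatio f (relMat A B) p) * transposeFun f t ^ p ≤
          transposeFun f (t ^ p) := fun t ht => by
      have ht0 : 0 < t := (relMat_isStrictlyPositive hb ha).spectrum_pos ht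
      have htp := Real.rpow_pos_of_pos ht0 p
      obtain ⟨h1, h2⟩ := powRatio_bounds hc hpos hC p (inv_mem_spectrum_relMat ha hb ht)
      have e1 : transposeFun f (t ^ p) = t ^ p * f ((t ^ (-1 : ℝ)) ^ p) := by
        rw [transposeFun, ← Real.rpow_mul ht0.le, ← Real.rpow_mul ht0.le, mul_comm p]
      have e2 : transposeFun f t ^ p = t ^ p * f (t ^ (-1 : ℝ)) ^ p :=
        Real.mul_rpow ht0.le (hpos _ (Real.rpow_pos_of_pos ht0 _)).le
      rw [e1, e2, mul_left_comm, mul_left_comm (lambdaMin _)]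
      exact ⟨mul_le_mul_of_nonneg_left h1 htp.le, mul_le_mul_of_nonneg_left h2 htp.le⟩
    have h := (hf.actsDecreasing_transposeFun h0 (Fin n)).perspective_majorization hb ha
      (opNorm_pos hr) (lambdaMin_pos hr) (opNorm_pos hP) (lambdaMin_pos hP)
      (fun t ht => (hbd t ht).1) (fun t ht => (hbd t ht).2) hPM hPμ
    rwa [ep, e] at h
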